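/- For integers $0\le k\le n$ let $\mathsf{U}_{k,n}$ be the uniform matroid on $[n]$ whose bases are all $k$-element subsets of $[n]$; it is loopless if and only if $k\ge 1$ or $n=0$. For a loopless matroid $\mathsf{M}$ on a finite ground set $E$ with lattice of flats $\mathcal{L}(\mathsf{M})$, the Chow ring of $\mathsf{M}$ is the quotient of $\mathbb{Q}[x_F : F\in\mathcal{L}(\mathsf{M})\setminus\{\varnothing,E\}]$ by the ideal generated by the products $x_Fx_G$ with $F,G$ incomparable and the linear forms $\sum_{F\ni i}x_F-\sum_{F\ni j}x_F$ with $i,j\in E$. The augmented Chow ring of $\mathsf{M}$ is the quotient of $\mathbb{Q}[x_F,y_i : F\in\mathcal{L}(\mathsf{M})\setminus\{E\},\ i\in E]$ by the ideal generated by the linear forms $y_i-\sum_{F\not\ni i}x_F$ with $i\in E$, the products $x_Fx_G$ with $F,G$ incomparable, and the products $y_ix_F$ with $i\notin F$. Both rings are graded with all variables in degree $1$; let $\underline{\mathrm{H}}_{\mathsf{M}}(x)$ and $\mathrm{H}_{\mathsf{M}}(x)$ denote their Hilbert series, that is, the generating functions of the $\mathbb{Q}$-dimensions of their graded pieces. Let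 $$A_j(x)=\sum_{\sigma\in\mathfrak{S}_j}x^{\operatorname{des}(\sigma)},\qquad d_j(x)=\sum_{\sigma\in\mathfrak{D}_j}x^{\operatorname{exc}(\sigma)}$$ be the Eulerian and derangement polynomials, where $\mathfrak{D}_j\subseteq\mathfrak{S}_j$ is the set of permutations without fixed points, $\operatorname{des}(\sigma)=|\{i\in[j-1]:\sigma_i>\sigma_{i+1}\}|$ and $\operatorname{exc}(\sigma)=|\{i\in[j]:\sigma_i>i\}|$; in particular $A_0=d_0=1$. Let $0\le k\le n$ be such that $\mathsf{U}_{k,n}$ is loopless. If $k\ge 1$, then $$\underline{\mathrm{H}}_{\mathsf{U}_{k,n}}(x)=\sum_{j=0}^{k-1}\binom{n}{j}\,d_j(x)\,(1+x+\cdots+x^{k-1-j}).$$ Moreover (also for $k=n=0$), $$\mathrm{H}_{\mathsf{U}_{k,n}}(x)=1+x\sum_{j=0}^{k-1}\binom{n}{j}\,A_j(x)\,(1+x+\cdots+x^{k-1-j}).$$ -/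

import Mathlib

open Polynomial

namespace Matroid

/-! ### Uniform matroids -/

/-- The family of `k`-element subsets of `Fin n` has the basis exchange property. -/
theorem exchangeProperty_ncard_eq (n k : ℕ) :
    ExchangeProperty (fun B : Set (Fin n) => B.ncard = k) := by
  intro B₁ B₂ h₁ h₂ a ha
  have hle : (B₁ \ B₂).ncard = (B₂ \ B₁).ncard :=
    (Set.ncard_eq_ncard_iff_ncard_sdiff_eq_ncard_sdiff (Set.toFinite _) (Set.toFinite _)).1
      (h₁.trans h₂.symm)
  have hpos : 0 < (B₁ \ B₂).ncard := (Set.ncard_pos (Set.toFinite _)).2 ⟨a, ha⟩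
  obtain ⟨b, hb⟩ := (Set.ncard_pos (Set.toFinite _)).1 (hle ▸ hpos)
  refine ⟨b, hb, ?_⟩
  change (insert b (B₁ \ {a})).ncard = k
  rw [Set.ncard_insert_of_notMem (fun h => hb.2 h.1) (Set.toFinite _),
    Set.ncard_sdiff_singleton_add_one ha.1 (Set.toFinite _)]
  exact h₁

/-- The uniform matroid `U_{k,n}` of rank `k` and cardinality `n` (`k ≤ n`): the ground set is
`Fin n` and the bases are all the `k`-element subsets. -/
def uniform (k n : ℕ) (hkn : k ≤ n) : Matroid (Fin n) :=
  Matroid.ofIsBaseOfFinite (E := Set.univ) Set.finite_univ (fun B => B.ncard = k)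
    (by
      obtain ⟨s, hs⟩ := Finset.exists_subset_card_eq (s := (Finset.univ : Finset (Fin n)))
        (n := k) (by simpa using hkn)
      exact ⟨(s : Set (Fin n)), by simpa [Set.ncard_coe_finset] using hs.2⟩)
    (exchangeProperty_ncard_eq n k) (fun _ _ => Set.subset_univ _)

instance uniform_finite (k n : ℕ) (hkn : k ≤ n) : (uniform k n hkn).Finite :=
  ⟨Set.toFinite _⟩

/-! ### Hilbert series of standard graded quotients of polynomial rings -/

/-- The degree `j` part of the quotient of the polynomial ring `ℚ[σ]` (all variables in degree
one) by an ideal `I`: the image of the space of homogeneous polynomials of degree `j`. -/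
noncomputable def quotientDegreePart {σ : Type*} (I : Ideal (MvPolynomial σ ℚ)) (j : ℕ) :
    Submodule ℚ (MvPolynomial σ ℚ ⧸ I) :=
  (MvPolynomial.homogeneousSubmodule σ ℚ j).map (Ideal.Quotient.mkₐ ℚ I).toLinearMap

/-- The Hilbert-Poincaré series of `ℚ[σ] ⧸ I`, for a homogeneous ideal `I`: the generating
function, over all degrees, of the dimensions of the graded parts. -/
noncomputable def quotientHilbertSeries {σ : Type*} (I : Ideal (MvPolynomial σ ℚ)) :
    PowerSeries ℤ :=
  PowerSeries.mk fun j => (Module.finrank ℚ (quotientDegreePart I j) : ℤ)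

/-! ### The Chow ring -/

/-- The flats of `M` other than `∅` and the ground set `E`. -/
abbrev ProperFlat {α : Type*} (M : Matroid α) : Type _ :=
  {F : Set α // M.IsFlat F ∧ F ≠ ∅ ∧ F ≠ M.E}

/-- The flats of `M` other than the ground set `E`. -/
abbrev NontopFlat {α : Type*} (M : Matroid α) : Type _ :=
  {F : Set α // M.IsFlat F ∧ F ≠ M.E}

theorem finite_setOf_isFlat {α : Type*} (M : Matroid α) [M.Finite] :
    {F : Set α | M.IsFlat F}.Finite :=
  M.ground_finite.finite_subsets.subset fun _ hF => hF.subset_ground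

noncomputable instance fintypeProperFlat {α : Type*} (M : Matroid α) [M.Finite] :
    Fintype M.ProperFlat :=
  (M.finite_setOf_isFlat.subset (fun _ hF => hF.1) :
    {F : Set α | M.IsFlat F ∧ F ≠ ∅ ∧ F ≠ M.E}.Finite).fintype

noncomputable instance fintypeNontopFlat {α : Type*} (M : Matroid α) [M.Finite] :
    Fintype M.NontopFlat :=
  (M.finite_setOf_isFlat.subset (fun _ hF => hF.1) :
    {F : Set α | M.IsFlat F ∧ F ≠ M.E}.Finite).fintype

open Classical in
/-- The linear form `∑_{F ∋ i} x_F`, over the flats `F ≠ ∅, E`. -/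
noncomputable def chowLinearForm {α : Type*} (M : Matroid α) [M.Finite] (i : α) :
    MvPolynomial M.ProperFlat ℚ :=
  ∑ F : M.ProperFlat with i ∈ F.1, MvPolynomial.X F

/-- The defining ideal of the Chow ring of a (loopless) matroid: it is generated by the products
`x_F x_G` with `F`, `G` incomparable, and by the differences
`∑_{F ∋ i} x_F - ∑_{F ∋ j} x_F` with `i, j ∈ E`. -/
noncomputable def chowIdeal {α : Type*} (M : Matroid α) [M.Finite] :
    Ideal (MvPolynomial M.ProperFlat ℚ) :=
  Ideal.span {p | ∃ F G : M.ProperFlat, ¬ F.1 ⊆ G.1 ∧ ¬ G.1 ⊆ F.1 ∧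
      p = MvPolynomial.X F * MvPolynomial.X G} ⊔
  Ideal.span {p | ∃ i ∈ M.E, ∃ j ∈ M.E, p = M.chowLinearForm i - M.chowLinearForm j}

/-- The Chow ring of a (loopless) matroid. -/
abbrev ChowRing {α : Type*} (M : Matroid α) [M.Finite] : Type _ :=
  MvPolynomial M.ProperFlat ℚ ⧸ M.chowIdeal

/-- The Hilbert-Poincaré series of the Chow ring. -/
noncomputable def chowHilbertSeries {α : Type*} (M : Matroid α) [M.Finite] : PowerSeries ℤ :=
  quotientHilbertSeries M.chowIdeal

/-! ### The augmented Chow ring -/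

/-- The variable `x_F` of the polynomial ring presenting the augmented Chow ring. -/
noncomputable def augX {α : Type*} (M : Matroid α) (F : M.NontopFlat) :
    MvPolynomial (M.NontopFlat ⊕ M.E) ℚ :=
  MvPolynomial.X (Sum.inl F)

/-- The variable `y_i` of the polynomial ring presenting the augmented Chow ring. -/
noncomputable def augY {α : Type*} (M : Matroid α) (i : M.E) :
    MvPolynomial (M.NontopFlat ⊕ M.E) ℚ :=
  MvPolynomial.X (Sum.inr i)

open Classical in
/-- The defining ideal of the augmented Chow ring of a (loopless) matroid: it is generated by the
linear forms `y_i - ∑_{F ∌ i} x_F`, the products `x_F x_G` with `F`, `G` incomparable, and the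
products `y_i x_F` with `i ∉ F`; here `F`, `G` run over the flats different from `E`. -/
noncomputable def augmentedChowIdeal {α : Type*} (M : Matroid α) [M.Finite] :
    Ideal (MvPolynomial (M.NontopFlat ⊕ M.E) ℚ) :=
  Ideal.span {p | ∃ i : M.E, p = M.augY i - ∑ F : M.NontopFlat with (i : α) ∉ F.1, M.augX F} ⊔
  (Ideal.span {p | ∃ F G : M.NontopFlat, ¬ F.1 ⊆ G.1 ∧ ¬ G.1 ⊆ F.1 ∧
      p = M.augX F * M.augX G} ⊔
   Ideal.span {p | ∃ (i : M.E) (F : M.NontopFlat), (i : α) ∉ F.1 ∧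
      p = M.augY i * M.augX F})

/-- The augmented Chow ring of a (loopless) matroid. -/
abbrev AugmentedChowRing {α : Type*} (M : Matroid α) [M.Finite] : Type _ :=
  MvPolynomial (M.NontopFlat ⊕ M.E) ℚ ⧸ M.augmentedChowIdeal

/-- The Hilbert-Poincaré series of the augmented Chow ring. -/
noncomputable def augmentedChowHilbertSeries {α : Type*} (M : Matroid α) [M.Finite] :
    PowerSeries ℤ :=
  quotientHilbertSeries M.augmentedChowIdeal

end Matroid

/-! ### Eulerian and derangement polynomials -/

/-- The number of descents of a permutation `σ` of `Fin n`: the number of positions `i` such that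
`i + 1` is also a position and `σ (i + 1) < σ i`. -/
def permDescents {n : ℕ} (σ : Equiv.Perm (Fin n)) : ℕ :=
  (Finset.univ.filter fun i : Fin n => ∃ h : i.val + 1 < n, σ ⟨i.val + 1, h⟩ < σ i).card

/-- The number of excedances of a permutation `σ` of `Fin n`. -/
def permExcedances {n : ℕ} (σ : Equiv.Perm (Fin n)) : ℕ :=
  (Finset.univ.filter fun i : Fin n => i < σ i).card

/-- The Eulerian polynomial `A_n = ∑_{σ ∈ S_n} x ^ des σ`; in particular `A_0 = 1`. -/
noncomputable def eulerianPoly (n : ℕ) : ℤ[X] :=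
  ∑ σ : Equiv.Perm (Fin n), X ^ permDescents σ

/-- The derangement polynomial `d_n = ∑_σ x ^ exc σ`, over the derangements `σ ∈ S_n`; in
particular `d_0 = 1`. -/
noncomputable def derangementPoly (n : ℕ) : ℤ[X] :=
  ∑ σ : derangements (Fin n), X ^ permExcedances (σ : Equiv.Perm (Fin n))

/-!
Both Chow rings are quotients of one polynomial ring, in variables `x_G` for all subsets `G` of
`Fin n` (`relIdeal`): variables of sets with at least `k` elements vanish, products of incomparable
variables vanish, and, writing `y_i = ∑_{G ∌ i} x_G`, the augmented ring has `x_F y_i = 0` for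
`i ∉ F` while the Chow ring has `y_i = 0`. Let `H_{k,n}` be the Hilbert series of either ring.

*Upper bound.* Let `α = ∑_G x_G`. Since `α` kills the flats of corank one, the ideal `(α)` is a
shifted quotient of the ring of the truncation `U_{k-1,n}` (`hilbertFn_relIdeal_succ_le`). Let
`K_{k,n}` be the Hilbert series after dividing by `α`. Dividing further by the variables of the
flats `F` of corank one gives the ring counted by `K_{k-1,n}`, and the principal ideal `(x_F)` is a
shifted quotient of the ring of `U_{j-1,j}`, with `j = |F| = k - 1`
(`hilbertFn_relIdealTotal_succ_le`). Hence, coefficientwise,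
`H_{k,n} ≤ K_{k,n} + x H_{k-1,n}` and `K_{k,n} ≤ K_{k-1,n} + (n choose j) x H_{j-1,j}`.
The polynomials of the theorem satisfy these recursions with equality, so they are upper bounds
(`hilbertFn_le_coeff`).

*Lower bound.* For `k = n` each maximal flag of subsets (in the augmented case each injective
sequence) gives a point at which the relations of the ring hold up to terms of lower degree; these
points correspond to the torus fixed points of the permutohedral and stellahedral varieties. The
quotient therefore has dimension at least the number of points (`exists_card_le_sum_hilbertFn`), which is the value at
`x = 1` of the upper bound. So the bound is sharp for `k = n`, and then the inequality
`H_{k,n} ≤ K_{k,n} + x H_{k-1,n}` forces equality for all smaller `k`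
(`hilbertFn_relIdeal_eq_coeff`). No basis of the rings is needed.

*Combinatorics.* Descents and excedances are equidistributed, by inserting a new smallest letter.
Grouping permutations by their fixed points gives `A_n = ∑_j (n choose j) d_j`, and a cyclic shift
turns excedances into weak excedances, so that `∑_j (n choose j) d_j x^{n-j} = x A_n` for `n > 0`.
These two identities yield the recursions for `d_j` and `A_j` matching those of the Hilbert series
(`derangementPoly_succ`, `eulerianPoly_succ_eq_sum`).
-/

/-! ### Hilbert functions of graded quotients -/

section HilbertFunction

open Matroid

variable {σ τ : Type*}

/-- The Hilbert function of `ℚ[σ] ⧸ I` for a homogeneous ideal `I`: the dimension of the degree `j`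
part. -/
noncomputable def hilbertFn (I : Ideal (MvPolynomial σ ℚ)) (j : ℕ) : ℕ :=
  Module.finrank ℚ (quotientDegreePart I j)

theorem coeff_quotientHilbertSeries (I : Ideal (MvPolynomial σ ℚ)) (j : ℕ) :
    PowerSeries.coeff j (quotientHilbertSeries I) = (hilbertFn I j : ℤ) := by
  simp [quotientHilbertSeries, hilbertFn]

instance finite_homogeneousSubmodule [Finite σ] (j : ℕ) :
    FiniteDimensional ℚ (MvPolynomial.homogeneousSubmodule σ ℚ j) :=
  Module.Finite.iff_fg.2 (MvPolynomial.homogeneousSubmodule_fg σ ℚ j)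

instance finite_quotientDegreePart [Finite σ] (I : Ideal (MvPolynomial σ ℚ)) (j : ℕ) :
    FiniteDimensional ℚ (quotientDegreePart I j) := by
  unfold quotientDegreePart; infer_instance

theorem homogeneousComponent_mul_of_mem {d : ℕ} {b : MvPolynomial σ ℚ}
    (hb : b ∈ MvPolynomial.homogeneousSubmodule σ ℚ d) (a : MvPolynomial σ ℚ) (j : ℕ) :
    MvPolynomial.homogeneousComponent (j + d) (a * b) =
      MvPolynomial.homogeneousComponent j a * b := by
  let _ := MvPolynomial.gradedAlgebra (σ := σ) (R := ℚ)
  have h := DirectSum.coe_decompose_mul_add_of_right_mem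
    (MvPolynomial.homogeneousSubmodule σ ℚ) (a := a) (i := j) hb
  have key : ∀ (p : MvPolynomial σ ℚ) (i : ℕ),
      ((DirectSum.decompose (MvPolynomial.homogeneousSubmodule σ ℚ) p i : _) : MvPolynomial σ ℚ)
        = MvPolynomial.homogeneousComponent i p :=
    fun p i => MvPolynomial.decomposition.decompose'_apply p i
  rwa [key, key] at h

theorem homogeneousComponent_mul_eq_zero_of_lt {d : ℕ} {b : MvPolynomial σ ℚ}
    (hb : b ∈ MvPolynomial.homogeneousSubmodule σ ℚ d) (a : MvPolynomial σ ℚ) {j : ℕ}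
    (hj : j < d) : MvPolynomial.homogeneousComponent j (a * b) = 0 := by
  let _ := MvPolynomial.gradedAlgebra (σ := σ) (R := ℚ)
  have h := DirectSum.coe_decompose_mul_of_right_mem_of_not_le
    (MvPolynomial.homogeneousSubmodule σ ℚ) (a := a) hb (not_le.2 hj)
  exact (MvPolynomial.decomposition.decompose'_apply _ _).symm.trans h

/-- An ideal of `ℚ[σ]` is homogeneous when it contains the homogeneous components of its
elements. -/
def IsGradedIdeal (I : Ideal (MvPolynomial σ ℚ)) : Prop :=
  ∀ p ∈ I, ∀ j, MvPolynomial.homogeneousComponent j p ∈ I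

theorem isGradedIdeal_span {s : Set (MvPolynomial σ ℚ)}
    (hs : ∀ p ∈ s, ∃ d, p ∈ MvPolynomial.homogeneousSubmodule σ ℚ d) :
    IsGradedIdeal (Ideal.span s) := by
  intro p hp j
  refine Submodule.span_induction (p := fun p _ => ∀ j,
    MvPolynomial.homogeneousComponent j p ∈ Ideal.span s) ?_ ?_ ?_ ?_ hp j
  · intro g hg j
    obtain ⟨d, hd⟩ := hs g hg
    rw [MvPolynomial.homogeneousComponent_of_mem hd]
    split_ifs
    · exact Ideal.subset_span hg
    · exact zero_mem _
  · simp
  · intro x y _ _ hx hy j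
    rw [map_add]
    exact add_mem (hx j) (hy j)
  · intro a x _ hx j
    rw [smul_eq_mul, ← MvPolynomial.sum_homogeneousComponent x, Finset.mul_sum, map_sum]
    refine sum_mem fun i _ => ?_
    have hi := MvPolynomial.homogeneousComponent_mem i x
    rcases lt_or_ge j i with h | h
    · rw [homogeneousComponent_mul_eq_zero_of_lt hi _ h]
      exact zero_mem _
    · obtain ⟨l, rfl⟩ := Nat.exists_eq_add_of_le' h
      rw [homogeneousComponent_mul_of_mem hi]
      exact Ideal.mul_mem_left _ _ (hx i)

/-- If multiplication of `a` by each variable is given, modulo `I`, by the image of a linear form,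
then multiplication by each form of degree `j` is given by the image of a form of degree `j`. -/
theorem exists_homogeneous_mul_sub_mem (I : Ideal (MvPolynomial σ ℚ))
    (φ : MvPolynomial τ ℚ →ₐ[ℚ] MvPolynomial σ ℚ) (a : MvPolynomial σ ℚ)
    (hX : ∀ s : σ, ∃ t ∈ MvPolynomial.homogeneousSubmodule τ ℚ 1,
      MvPolynomial.X s * a - φ t * a ∈ I) (j : ℕ) :
    ∀ p ∈ MvPolynomial.homogeneousSubmodule σ ℚ j,
      ∃ t ∈ MvPolynomial.homogeneousSubmodule τ ℚ j, p * a - φ t * a ∈ I := by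
  induction j with
  | zero =>
    intro p hp
    rw [MvPolynomial.mem_homogeneousSubmodule, ← MvPolynomial.totalDegree_zero_iff_isHomogeneous,
      MvPolynomial.totalDegree_eq_zero_iff_eq_C] at hp
    refine ⟨MvPolynomial.C (p.coeff 0), MvPolynomial.isHomogeneous_C _ _, ?_⟩
    rw [hp]
    simp [← MvPolynomial.algebraMap_eq]
  | succ j ih =>
    intro p hp
    rw [← MvPolynomial.homogeneousSubmodule_one_pow, pow_succ,
      MvPolynomial.homogeneousSubmodule_one_pow] at hp
    refine Submodule.mul_induction_on hp ?_ ?_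
    · intro q hq l hl
      obtain ⟨t, ht, hqt⟩ := ih q hq
      have hl' : ∃ u ∈ MvPolynomial.homogeneousSubmodule τ ℚ 1, l * a - φ u * a ∈ I := by
        rw [MvPolynomial.homogeneousSubmodule_one_eq_span_X] at hl
        refine Submodule.span_induction ?_ ?_ ?_ ?_ hl
        · rintro _ ⟨s, rfl⟩
          exact hX s
        · exact ⟨0, zero_mem _, by simp⟩
        · rintro x y _ _ ⟨u, hu, hxu⟩ ⟨v, hv, hyv⟩
          refine ⟨u + v, add_mem hu hv, ?_⟩
          convert add_mem hxu hyv using 1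
          rw [map_add]; ring
        · rintro c x _ ⟨u, hu, hxu⟩
          refine ⟨c • u, Submodule.smul_mem _ _ hu, ?_⟩
          convert Submodule.smul_of_tower_mem I c hxu using 1
          rw [map_smul, smul_sub, smul_mul_assoc, smul_mul_assoc]
      obtain ⟨u, hu, hlu⟩ := hl'
      refine ⟨t * u, ht.mul hu, ?_⟩
      have := add_mem (I.mul_mem_left l hqt) (I.mul_mem_left (φ t) hlu)
      convert this using 1
      rw [map_mul]; ring
    · rintro x y ⟨u, hu, hxu⟩ ⟨v, hv, hyv⟩
      refine ⟨u + v, add_mem hu hv, ?_⟩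
      convert add_mem hxu hyv using 1
      rw [map_add]; ring

/-- The image of `p ↦ p * a` in `ℚ[σ] ⧸ I`, restricted to polynomials of degree `j`. -/
noncomputable def mulDegreePart (I : Ideal (MvPolynomial σ ℚ)) (a : MvPolynomial σ ℚ) (j : ℕ) :
    Submodule ℚ (MvPolynomial σ ℚ ⧸ I) :=
  (MvPolynomial.homogeneousSubmodule σ ℚ j).map
    ((Ideal.Quotient.mkₐ ℚ I).toLinearMap ∘ₗ LinearMap.mulRight ℚ a)

instance finite_mulDegreePart [Finite σ] (I : Ideal (MvPolynomial σ ℚ)) (a : MvPolynomial σ ℚ)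
    (j : ℕ) : FiniteDimensional ℚ (mulDegreePart I a j) := by
  unfold mulDegreePart; infer_instance

/-- If `t ↦ φ t * a` kills `J` modulo `I` and reaches all of `(a)` modulo `I`, the principal
ideal `(a)` of `ℚ[σ] ⧸ I` is a quotient of a shift of `ℚ[τ] ⧸ J`. -/
theorem finrank_mulDegreePart_le [Finite τ] (I : Ideal (MvPolynomial σ ℚ))
    (J : Ideal (MvPolynomial τ ℚ)) (φ : MvPolynomial τ ℚ →ₐ[ℚ] MvPolynomial σ ℚ)
    (a : MvPolynomial σ ℚ) (hJ : ∀ p ∈ J, φ p * a ∈ I)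
    (hX : ∀ s : σ, ∃ t ∈ MvPolynomial.homogeneousSubmodule τ ℚ 1,
      MvPolynomial.X s * a - φ t * a ∈ I) (j : ℕ) :
    Module.finrank ℚ (mulDegreePart I a j) ≤ hilbertFn J j := by
  let ψ : MvPolynomial τ ℚ →ₗ[ℚ] MvPolynomial σ ℚ ⧸ I :=
    (Ideal.Quotient.mkₐ ℚ I).toLinearMap ∘ₗ LinearMap.mulRight ℚ a ∘ₗ φ.toLinearMap
  have hψ : (J.restrictScalars ℚ) ≤ LinearMap.ker ψ := fun p hp =>
    Ideal.Quotient.eq_zero_iff_mem.2 (hJ p hp)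
  let ψ' : (MvPolynomial τ ℚ ⧸ J) →ₗ[ℚ] MvPolynomial σ ℚ ⧸ I :=
    (J.restrictScalars ℚ).liftQ ψ hψ
  have hle : mulDegreePart I a j ≤ (quotientDegreePart J j).map ψ' := by
    rintro _ ⟨p, hp, rfl⟩
    obtain ⟨t, ht, h⟩ := exists_homogeneous_mul_sub_mem I φ a hX j p hp
    refine ⟨Ideal.Quotient.mkₐ ℚ J t, ⟨t, ht, rfl⟩, ?_⟩
    exact (Ideal.Quotient.eq.2 h).symm
  exact (Submodule.finrank_mono hle).trans (Submodule.finrank_map_le _ _)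

theorem mulDegreePart_one (I : Ideal (MvPolynomial σ ℚ)) (j : ℕ) :
    mulDegreePart I 1 j = quotientDegreePart I j := by
  rw [mulDegreePart, quotientDegreePart, LinearMap.mulRight_one, LinearMap.comp_id]

/-- A ring homomorphism inducing a surjection `ℚ[τ] ⧸ J → ℚ[σ] ⧸ I` that lifts each variable to a
linear form bounds the Hilbert function. -/
theorem hilbertFn_le_of_surjective [Finite τ] (I : Ideal (MvPolynomial σ ℚ))
    (J : Ideal (MvPolynomial τ ℚ)) (φ : MvPolynomial τ ℚ →ₐ[ℚ] MvPolynomial σ ℚ)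
    (hJ : ∀ p ∈ J, φ p ∈ I)
    (hX : ∀ s : σ, ∃ t ∈ MvPolynomial.homogeneousSubmodule τ ℚ 1, MvPolynomial.X s - φ t ∈ I)
    (j : ℕ) : hilbertFn I j ≤ hilbertFn J j := by
  have := finrank_mulDegreePart_le I J φ 1 (by simpa using hJ) (by simpa using hX) j
  rwa [mulDegreePart_one] at this

theorem finrank_finset_sup_le {ι V : Type*} [AddCommGroup V] [Module ℚ V] (s : Finset ι)
    (W : ι → Submodule ℚ V) [∀ i, FiniteDimensional ℚ (W i)] :
    Module.finrank ℚ (s.sup W : Submodule ℚ V) ≤ ∑ i ∈ s, Module.finrank ℚ (W i) := by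
  classical
  induction s using Finset.induction_on with
  | empty => simp
  | insert i s hi ih =>
    rw [Finset.sup_insert, Finset.sum_insert hi]
    exact (Submodule.finrank_add_le_finrank_add_finrank _ _).trans (by gcongr)

/-- Killing linear forms `a i` costs at most the dimensions of the principal ideals they
generate. -/
theorem hilbertFn_succ_le [Finite σ] {ι : Type*} [Fintype ι] {I : Ideal (MvPolynomial σ ℚ)}
    (hI : IsGradedIdeal I) (a : ι → MvPolynomial σ ℚ)
    (ha : ∀ i, a i ∈ MvPolynomial.homogeneousSubmodule σ ℚ 1) (j : ℕ) :
    hilbertFn I (j + 1) ≤ hilbertFn (I ⊔ Ideal.span (Set.range a)) (j + 1) +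
      ∑ i, Module.finrank ℚ (mulDegreePart I (a i) j) := by
  set I' := I ⊔ Ideal.span (Set.range a)
  let q : (MvPolynomial σ ℚ ⧸ I) →ₗ[ℚ] (MvPolynomial σ ℚ ⧸ I') :=
    (Ideal.Quotient.factorₐ ℚ (le_sup_left : I ≤ I')).toLinearMap
  set W := quotientDegreePart I (j + 1)
  have hrn := (q.domRestrict W).finrank_range_add_finrank_ker
  have hrange : Module.finrank ℚ (LinearMap.range (q.domRestrict W)) = hilbertFn I' (j + 1) := by
    have : LinearMap.range (q.domRestrict W) = quotientDegreePart I' (j + 1) := by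
      rw [LinearMap.range_domRestrict]
      change (Submodule.map _ _).map _ = _
      rw [← Submodule.map_comp]
      rfl
    rw [this, hilbertFn]
  have hker : Module.finrank ℚ (LinearMap.ker (q.domRestrict W)) ≤
      ∑ i, Module.finrank ℚ (mulDegreePart I (a i) j) := by
    refine le_trans ?_ (finrank_finset_sup_le Finset.univ fun i => mulDegreePart I (a i) j)
    rw [← Submodule.finrank_map_subtype_eq]
    refine Submodule.finrank_mono ?_
    rintro _ ⟨⟨_, p, hp, rfl⟩, hx, rfl⟩
    have hp' : p ∈ I' := Ideal.Quotient.eq_zero_iff_mem.1 hx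
    obtain ⟨u, hu, v, hv, huv⟩ := Submodule.mem_sup.1 hp'
    obtain ⟨c, rfl⟩ := Ideal.mem_span_range_iff_exists_fun.1 hv
    have hpe : p = MvPolynomial.homogeneousComponent (j + 1) u +
        ∑ i, MvPolynomial.homogeneousComponent j (c i) * a i := by
      rw [← MvPolynomial.homogeneousComponent_eq_self hp, ← huv, map_add, map_sum]
      simp_rw [homogeneousComponent_mul_of_mem (ha _)]
    have : (Ideal.Quotient.mkₐ ℚ I) p =
        ∑ i, (Ideal.Quotient.mkₐ ℚ I) (MvPolynomial.homogeneousComponent j (c i) * a i) := by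
      rw [← map_sum]
      refine Ideal.Quotient.eq.2 ?_
      nth_rewrite 1 [hpe]
      simpa using hI u hu (j + 1)
    change (Ideal.Quotient.mkₐ ℚ I) p ∈ _
    rw [this]
    refine sum_mem fun i _ => ?_
    exact Finset.le_sup (f := fun i => mulDegreePart I (a i) j) (Finset.mem_univ i)
      ⟨_, MvPolynomial.homogeneousComponent_mem j (c i), rfl⟩
  change Module.finrank ℚ W ≤ _
  omega

/-- In degree zero nothing is lost by killing linear forms. -/
theorem hilbertFn_zero_le [Finite σ] {ι : Type*} [Fintype ι] {I : Ideal (MvPolynomial σ ℚ)}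
    (hI : IsGradedIdeal I) (a : ι → MvPolynomial σ ℚ)
    (ha : ∀ i, a i ∈ MvPolynomial.homogeneousSubmodule σ ℚ 1) :
    hilbertFn I 0 ≤ hilbertFn (I ⊔ Ideal.span (Set.range a)) 0 := by
  set I' := I ⊔ Ideal.span (Set.range a)
  let q : (MvPolynomial σ ℚ ⧸ I) →ₗ[ℚ] (MvPolynomial σ ℚ ⧸ I') :=
    (Ideal.Quotient.factorₐ ℚ (le_sup_left : I ≤ I')).toLinearMap
  have hmap : quotientDegreePart I' 0 = (quotientDegreePart I 0).map q := by
    change _ = (Submodule.map _ _).map _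
    rw [← Submodule.map_comp]
    rfl
  have hinj : Function.Injective (q.domRestrict (quotientDegreePart I 0)) := by
    rw [← LinearMap.ker_eq_bot, eq_bot_iff]
    rintro ⟨_, p, hp, rfl⟩ hx
    have hp' : p ∈ I' := Ideal.Quotient.eq_zero_iff_mem.1 hx
    obtain ⟨u, hu, v, hv, huv⟩ := Submodule.mem_sup.1 hp'
    obtain ⟨c, rfl⟩ := Ideal.mem_span_range_iff_exists_fun.1 hv
    have hpe : p = MvPolynomial.homogeneousComponent 0 u := by
      rw [← MvPolynomial.homogeneousComponent_eq_self hp, ← huv, map_add, map_sum]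
      simp_rw [homogeneousComponent_mul_eq_zero_of_lt (ha _) _ zero_lt_one]
      simp
    refine Subtype.ext (Ideal.Quotient.eq_zero_iff_mem.2 ?_)
    rw [hpe]
    exact hI u hu 0
  rw [hilbertFn, hilbertFn, hmap, ← LinearMap.range_domRestrict,
    LinearMap.finrank_range_of_inj hinj]

end HilbertFunction

/-! ### A common presentation of the two Chow rings of a uniform matroid -/

section Presentation

open MvPolynomial in
/-- The form `∑_{G ∌ i} x_G`, over all subsets `G` of `Fin n`. -/
noncomputable def avoidForm {n : ℕ} (i : Fin n) : MvPolynomial (Finset (Fin n)) ℚ :=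
  ∑ G with i ∉ G, X G

open MvPolynomial in
/-- The form `∑_G x_G`, over all subsets `G` of `Fin n`. -/
noncomputable def totalForm (n : ℕ) : MvPolynomial (Finset (Fin n)) ℚ :=
  ∑ G, X G

open MvPolynomial in
/-- The relations, in variables `x_G` indexed by all subsets `G` of `Fin n`, of the Chow ring
(if `c` holds) or the augmented Chow ring (if `c` fails) of the uniform matroid `U_{k,n}`.
The variables of sets of size at least `k` vanish. In the augmented ring `y_i` has been replaced
by `∑_{G ∌ i} x_G`. The Chow ring is its quotient by all `y_i`, so `x_∅` stands for minus the
sum of the `x_F` over the nonempty proper flats `F` avoiding any one element. For `k = 0` the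
Chow ring is taken to be zero. -/
inductive IsRel (c : Prop) (n k : ℕ) : MvPolynomial (Finset (Fin n)) ℚ → Prop
  | large (G : Finset (Fin n)) (h : k ≤ G.card) : IsRel c n k (X G)
  | incomp (F G : Finset (Fin n)) (h : ¬ F ⊆ G) (h' : ¬ G ⊆ F) : IsRel c n k (X F * X G)
  | aug (F : Finset (Fin n)) (i : Fin n) (h : i ∉ F) : IsRel c n k (X F * avoidForm i)
  | chow (i : Fin n) (h : c) : IsRel c n k (avoidForm i)
  | unit (h : c) (hk : k = 0) : IsRel c n k 1

/-- The ideal generated by the relations `IsRel c n k`. -/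
noncomputable def relIdeal (c : Prop) (n k : ℕ) : Ideal (MvPolynomial (Finset (Fin n)) ℚ) :=
  Ideal.span {p | IsRel c n k p}

/-- The ideal `relIdeal c n k` enlarged by the form `∑_G x_G`. -/
noncomputable def relIdealTotal (c : Prop) (n k : ℕ) :
    Ideal (MvPolynomial (Finset (Fin n)) ℚ) :=
  relIdeal c n k ⊔ Ideal.span (Set.range fun _ : Unit => totalForm n)

open MvPolynomial

variable {c : Prop} {n k : ℕ}

theorem IsRel.mem {p : MvPolynomial (Finset (Fin n)) ℚ} (h : IsRel c n k p) :
    p ∈ relIdeal c n k := Ideal.subset_span h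

theorem avoidForm_mem_homogeneous (i : Fin n) :
    avoidForm i ∈ homogeneousSubmodule (Finset (Fin n)) ℚ 1 :=
  sum_mem fun _ _ => isHomogeneous_X _ _

theorem totalForm_mem_homogeneous (n : ℕ) :
    totalForm n ∈ homogeneousSubmodule (Finset (Fin n)) ℚ 1 :=
  sum_mem fun _ _ => isHomogeneous_X _ _

theorem IsRel.isHomogeneous {p : MvPolynomial (Finset (Fin n)) ℚ} (h : IsRel c n k p) :
    ∃ d, p ∈ homogeneousSubmodule (Finset (Fin n)) ℚ d := by
  cases h with
  | large G h => exact ⟨1, isHomogeneous_X _ _⟩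
  | incomp F G h h' => exact ⟨2, (isHomogeneous_X _ _).mul (isHomogeneous_X _ _)⟩
  | aug F i h => exact ⟨2, (isHomogeneous_X _ _).mul (avoidForm_mem_homogeneous i)⟩
  | chow i h => exact ⟨1, avoidForm_mem_homogeneous i⟩
  | unit h hk => exact ⟨0, isHomogeneous_one _ _⟩

theorem isGradedIdeal_relIdeal : IsGradedIdeal (relIdeal c n k) :=
  isGradedIdeal_span fun _ h => h.isHomogeneous

theorem isGradedIdeal_relIdealTotal : IsGradedIdeal (relIdealTotal c n k) := by
  rw [relIdealTotal, relIdeal, ← Ideal.span_union]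
  refine isGradedIdeal_span ?_
  rintro p (h | ⟨_, rfl⟩)
  · exact h.isHomogeneous
  · exact ⟨1, totalForm_mem_homogeneous n⟩

theorem totalForm_sub_avoidForm (i : Fin n) :
    totalForm n - avoidForm i = ∑ G : Finset (Fin n) with i ∈ G, X G := by
  rw [totalForm, avoidForm, sub_eq_iff_eq_add, Finset.sum_filter_add_sum_filter_not]

theorem relIdeal_le_relIdealTotal : relIdeal c n k ≤ relIdealTotal c n k := le_sup_left

theorem totalForm_mem : totalForm n ∈ relIdealTotal c n k :=
  Ideal.mem_sup_right (Ideal.subset_span ⟨(), rfl⟩)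

theorem X_mul_totalForm_sub_avoidForm_mem {G : Finset (Fin n)} {i : Fin n} (hi : i ∉ G)
    (hk : k ≤ G.card + 1) : X G * (totalForm n - avoidForm i) ∈ relIdeal c n k := by
  rw [totalForm_sub_avoidForm, Finset.mul_sum]
  refine sum_mem fun H hH => ?_
  have hiH : i ∈ H := (Finset.mem_filter.1 hH).2
  by_cases hGH : G ⊆ H
  · refine Ideal.mul_mem_left _ _ (IsRel.large H ?_).mem
    have : G.card < H.card := Finset.card_lt_card ⟨hGH, fun h => hi (h hiH)⟩
    omega
  · exact (IsRel.incomp G H hGH fun h => hi (h hiH)).mem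

/-- Flats of corank one are annihilated by `∑_G x_G`. -/
theorem X_mul_totalForm_mem {G : Finset (Fin n)} (hG : G.card < n) (hk : k ≤ G.card + 1) :
    X G * totalForm n ∈ relIdeal c n k := by
  obtain ⟨i, hi⟩ : ∃ i, i ∉ G := by
    by_contra! h
    have : G = Finset.univ := Finset.eq_univ_iff_forall.2 h
    simp [this] at hG
  have h1 := X_mul_totalForm_sub_avoidForm_mem (c := c) hi hk
  have h2 := (IsRel.aug (c := c) (k := k) G i hi).mem
  convert add_mem h1 h2 using 1
  ring

theorem totalForm_mem_relIdeal_one (hc : c) (hn : 0 < n) : totalForm n ∈ relIdeal c n 1 := by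
  have h1 := (IsRel.chow (c := c) (k := 1) (⟨0, hn⟩ : Fin n) hc).mem
  have h2 : totalForm n - avoidForm (⟨0, hn⟩ : Fin n) ∈ relIdeal c n 1 := by
    rw [totalForm_sub_avoidForm]
    refine sum_mem fun H hH => (IsRel.large H ?_).mem
    exact Finset.card_pos.2 ⟨_, (Finset.mem_filter.1 hH).2⟩
  convert add_mem h2 h1 using 1
  ring

/-- Multiplication by `∑_G x_G` is well defined from the ring of the truncation. -/
theorem mul_totalForm_mem (hk : k < n) {p : MvPolynomial (Finset (Fin n)) ℚ}
    (hp : p ∈ relIdeal c n k) : p * totalForm n ∈ relIdeal c n (k + 1) := by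
  refine Submodule.span_induction (p := fun p _ => p * totalForm n ∈ relIdeal c n (k + 1))
    ?_ ?_ ?_ ?_ hp
  · rintro p hp
    cases hp with
    | large G h =>
      by_cases hG : k + 1 ≤ G.card
      · exact Ideal.mul_mem_right _ _ (IsRel.large G hG).mem
      · exact X_mul_totalForm_mem (by omega) (by omega)
    | incomp F G h h' => exact Ideal.mul_mem_right _ _ (IsRel.incomp F G h h').mem
    | aug F i h => exact Ideal.mul_mem_right _ _ (IsRel.aug F i h).mem
    | chow i h => exact Ideal.mul_mem_right _ _ (IsRel.chow i h).mem
    | unit h hk0 =>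
      subst hk0
      exact Ideal.mul_mem_left _ _ (totalForm_mem_relIdeal_one h hk)
  · simp
  · intro x y _ _ hx hy
    rw [add_mul]; exact add_mem hx hy
  · intro a x _ hx
    rw [smul_eq_mul, mul_assoc]; exact Ideal.mul_mem_left _ _ hx

/-- The principal ideal of `∑_G x_G` is a shifted quotient of the ring of the truncation. -/
theorem hilbertFn_relIdeal_succ_le (hk : k < n) (j : ℕ) :
    hilbertFn (relIdeal c n (k + 1)) (j + 1) ≤
      hilbertFn (relIdealTotal c n (k + 1)) (j + 1) + hilbertFn (relIdeal c n k) j := by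
  refine (hilbertFn_succ_le isGradedIdeal_relIdeal (fun _ : Unit => totalForm n)
    (fun _ => totalForm_mem_homogeneous n) j).trans ?_
  rw [Fintype.sum_unique]
  refine Nat.add_le_add_left (finrank_mulDegreePart_le _ _ (AlgHom.id ℚ _) _ ?_ ?_ j) _
  · exact fun p hp => mul_totalForm_mem hk hp
  · exact fun s => ⟨X s, isHomogeneous_X _ _, by simp⟩

theorem hilbertFn_relIdeal_zero_le :
    hilbertFn (relIdeal c n k) 0 ≤ hilbertFn (relIdealTotal c n k) 0 :=
  hilbertFn_zero_le isGradedIdeal_relIdeal (fun _ : Unit => totalForm n)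
    (fun _ => totalForm_mem_homogeneous n)

/-! ### Removing the flats of corank one -/

open Classical in
/-- For `F` the image of `e`, the substitution of the variables of the subsets of `F` that
represents multiplication by `x_F`; the variable of `F` itself is sent to zero. -/
noncomputable def restrictHom (e : Fin k ↪ Fin n) :
    MvPolynomial (Finset (Fin k)) ℚ →ₐ[ℚ] MvPolynomial (Finset (Fin n)) ℚ :=
  aeval fun G => if G = Finset.univ then 0 else X (G.map e)

theorem restrictHom_X_univ (e : Fin k ↪ Fin n) : restrictHom e (X Finset.univ) = 0 := by
  simp [restrictHom]

theorem restrictHom_X (e : Fin k ↪ Fin n) {G : Finset (Fin k)} (hG : G ≠ Finset.univ) :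
    restrictHom e (X G) = X (G.map e) := by
  simp [restrictHom, hG]

/-- Modulo `∑_G x_G`, a flat `G` of corank two and a flat `F = G ∪ {i}` of corank one have product
zero: `x_G ∑_{H ∋ i} x_H` vanishes, and all its terms but `x_G x_F` do. -/
theorem X_mul_X_mem_of_card {F G : Finset (Fin n)} (hF : F.card = k)
    (hGF : G ⊆ F) (hG : G.card + 1 = k) : X G * X F ∈ relIdealTotal c n (k + 1) := by
  obtain ⟨i, hi⟩ : ∃ i, F \ G = {i} := by
    rw [← Finset.card_eq_one, Finset.card_sdiff_of_subset hGF]; omega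
  have hiF : i ∈ F \ G := by simp [hi]
  rw [Finset.mem_sdiff] at hiF
  have hsum : X G * (totalForm n - avoidForm i) ∈ relIdealTotal c n (k + 1) := by
    rw [mul_sub]
    exact sub_mem (Ideal.mul_mem_left _ _ totalForm_mem)
      (relIdeal_le_relIdealTotal (IsRel.aug G i hiF.2).mem)
  rw [totalForm_sub_avoidForm, Finset.mul_sum, ← Finset.sum_erase_add _ _
    (Finset.mem_filter.2 ⟨Finset.mem_univ F, hiF.1⟩)] at hsum
  refine (Submodule.add_mem_iff_right _ (sum_mem fun H hH => ?_)).1 hsum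
  obtain ⟨hHF, hH⟩ := Finset.mem_erase.1 hH
  have hiH : i ∈ H := (Finset.mem_filter.1 hH).2
  refine relIdeal_le_relIdealTotal ?_
  by_cases hGH : G ⊆ H
  · refine Ideal.mul_mem_left _ _ (IsRel.large H ?_).mem
    have hFH : F ⊆ H := by
      intro x hx
      by_cases hxG : x ∈ G
      · exact hGH hxG
      · have : x ∈ F \ G := Finset.mem_sdiff.2 ⟨hx, hxG⟩
        rw [hi, Finset.mem_singleton] at this
        exact this ▸ hiH
    have : F.card < H.card :=
      Finset.card_lt_card ⟨hFH, fun h => hHF (Finset.Subset.antisymm h hFH)⟩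
    omega
  · exact (IsRel.incomp G H hGH fun h => hiF.2 (h hiH)).mem

/-- After multiplication by `x_F`, only the subsets of `F` contribute to `∑_{G ∌ i} x_G` when
`i ∈ F`. -/
theorem restrictHom_avoidForm_sub_mem (e : Fin k ↪ Fin n) (i : Fin k) :
    restrictHom e (avoidForm i) * X (Finset.univ.map e) -
      avoidForm (e i) * X (Finset.univ.map e) ∈ relIdeal c n (k + 1) := by
  classical
  have h1 : restrictHom e (avoidForm i) =
      ∑ H ∈ (Finset.univ.filter fun G : Finset (Fin k) => i ∉ G).map
        (Finset.mapEmbedding e).toEmbedding, X H := by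
    rw [avoidForm, map_sum, Finset.sum_map]
    refine Finset.sum_congr rfl fun G hG => restrictHom_X e ?_
    rintro rfl
    simp at hG
  have hsub : (Finset.univ.filter fun G : Finset (Fin k) => i ∉ G).map
      (Finset.mapEmbedding e).toEmbedding ⊆ Finset.univ.filter fun G => e i ∉ G := by
    intro H
    simp only [Finset.mem_map, Finset.mem_filter, Finset.mem_univ, true_and]
    rintro ⟨G, hG, rfl⟩
    simpa [Finset.mapEmbedding_apply] using hG
  rw [← sub_mul, h1, avoidForm, ← Finset.sum_sdiff hsub, sub_add_cancel_right, neg_mul, neg_mem_iff,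
    Finset.sum_mul]
  refine sum_mem fun H hH => ?_
  obtain ⟨hH1, hH2⟩ := Finset.mem_sdiff.1 hH
  have hiH : e i ∉ H := (Finset.mem_filter.1 hH1).2
  refine (IsRel.incomp H _ ?_ fun h => hiH (h (by simp))).mem
  intro hHF
  obtain ⟨G, -, rfl⟩ := Finset.subset_map_iff.1 hHF
  exact hH2 (Finset.mem_map.2 ⟨G, by simpa using hiH, rfl⟩)

theorem restrictHom_mul_mem (hk : 0 < k) (e : Fin k ↪ Fin n)
    {p : MvPolynomial (Finset (Fin k)) ℚ} (hp : p ∈ relIdeal c k (k - 1)) :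
    restrictHom e p * X (Finset.univ.map e) ∈ relIdealTotal c n (k + 1) := by
  have hlarge : ∀ G : Finset (Fin k), k - 1 ≤ G.card →
      restrictHom e (X G) * X (Finset.univ.map e) ∈ relIdealTotal c n (k + 1) := by
    intro G h
    by_cases hG : G = Finset.univ
    · rw [hG, restrictHom_X_univ, zero_mul]; exact zero_mem _
    · rw [restrictHom_X e hG]
      refine X_mul_X_mem_of_card (by simp) (Finset.map_subset_map.2 (Finset.subset_univ _)) ?_
      have := (Finset.card_lt_iff_ne_univ G).2 hG
      rw [Fintype.card_fin] at this
      rw [Finset.card_map]; omega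
  have havoid : ∀ (q : MvPolynomial (Finset (Fin n)) ℚ) (i : Fin k),
      q * avoidForm (e i) ∈ relIdeal c n (k + 1) →
      q * (restrictHom e (avoidForm i) * X (Finset.univ.map e)) ∈ relIdealTotal c n (k + 1) := by
    intro q i h
    refine relIdeal_le_relIdealTotal ?_
    convert add_mem (Ideal.mul_mem_left _ q (restrictHom_avoidForm_sub_mem e i))
      (Ideal.mul_mem_right (X (Finset.univ.map e)) _ h) using 1
    ring
  refine Submodule.span_induction
    (p := fun p _ => restrictHom e p * X (Finset.univ.map e) ∈ relIdealTotal c n (k + 1))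
    ?_ ?_ ?_ ?_ hp
  · rintro p hp
    cases hp with
    | large G h => exact hlarge G h
    | incomp F G h h' =>
      have hF : F ≠ Finset.univ := by rintro rfl; exact h' (Finset.subset_univ _)
      have hG : G ≠ Finset.univ := by rintro rfl; exact h (Finset.subset_univ _)
      rw [map_mul, restrictHom_X e hF, restrictHom_X e hG]
      refine Ideal.mul_mem_right _ _ (relIdeal_le_relIdealTotal (IsRel.incomp _ _ ?_ ?_).mem)
      · rwa [Finset.map_subset_map]
      · rwa [Finset.map_subset_map]
    | aug F i h =>
      have hF : F ≠ Finset.univ := by rintro rfl; simp at h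
      rw [map_mul, restrictHom_X e hF, mul_assoc]
      exact havoid _ _ (IsRel.aug _ _ (by simpa using h)).mem
    | chow i h =>
      have := havoid 1 i (by simpa using (IsRel.chow (e i) h).mem)
      simpa using this
    | unit h hk0 =>
      -- Here `k = 1`: the sum of the `x_G` over `G ∋ i` reduces to `x_{i}`.
      obtain rfl : k = 1 := by omega
      have h1 : totalForm n - avoidForm (e 0) ∈ relIdealTotal c n 2 :=
        sub_mem totalForm_mem (relIdeal_le_relIdealTotal (IsRel.chow (e 0) h).mem)
      have hF : (Finset.univ.map e : Finset (Fin n)) = {e 0} := by simp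
      rw [totalForm_sub_avoidForm, ← Finset.sum_erase_add _ _
        (show ({e 0} : Finset (Fin n)) ∈ Finset.univ.filter (e 0 ∈ ·) by simp)] at h1
      rw [map_one, one_mul, hF]
      refine (Submodule.add_mem_iff_right _ (sum_mem fun H hH => ?_)).1 h1
      obtain ⟨hH1, hH2⟩ := Finset.mem_erase.1 hH
      have h0 : e 0 ∈ H := (Finset.mem_filter.1 hH2).2
      refine relIdeal_le_relIdealTotal (IsRel.large H ?_).mem
      have : ({e 0} : Finset (Fin n)).card < H.card := Finset.card_lt_card
        (Finset.ssubset_iff_subset_ne.2 ⟨by simpa using h0, hH1.symm⟩)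
      rwa [Finset.card_singleton] at this
  · simp
  · intro x y _ _ hx hy
    rw [map_add, add_mul]; exact add_mem hx hy
  · intro a x _ hx
    rw [smul_eq_mul, map_mul, mul_assoc]; exact Ideal.mul_mem_left _ _ hx

theorem exists_X_mul_sub_restrictHom_mem (e : Fin k ↪ Fin n) (G : Finset (Fin n)) :
    ∃ t ∈ homogeneousSubmodule (Finset (Fin k)) ℚ 1,
      X G * X (Finset.univ.map e) - restrictHom e t * X (Finset.univ.map e) ∈
        relIdealTotal c n (k + 1) := by
  classical
  set F := (Finset.univ.map e : Finset (Fin n)) with hF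
  by_cases hGF : G ⊆ F
  · by_cases hEq : G = F
    · -- `x_F ^ 2 = - ∑_{G ⊂ F} x_G x_F`, since `∑_G x_G = 0`.
      refine ⟨-∑ H with H ≠ Finset.univ, X H,
        neg_mem (sum_mem fun _ _ => isHomogeneous_X _ _), ?_⟩
      rw [hEq, map_neg, neg_mul, sub_neg_eq_add, map_sum]
      have h1 : ∑ H : Finset (Fin k) with H ≠ Finset.univ, restrictHom e (X H) =
          ∑ H ∈ (Finset.univ.filter fun H : Finset (Fin k) => H ≠ Finset.univ).map
            (Finset.mapEmbedding e).toEmbedding, X H := by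
        rw [Finset.sum_map]
        exact Finset.sum_congr rfl fun H hH => restrictHom_X e (Finset.mem_filter.1 hH).2
      have hnot : F ∉ (Finset.univ.filter fun H : Finset (Fin k) => H ≠ Finset.univ).map
            (Finset.mapEmbedding e).toEmbedding := by
        simp [hF, Finset.mapEmbedding_apply]
      have h2 : totalForm n * X F ∈ relIdealTotal c n (k + 1) :=
        Ideal.mul_mem_right _ _ totalForm_mem
      rw [h1, ← add_mul, ← Finset.sum_insert hnot]
      rw [totalForm, ← Finset.sum_sdiff (Finset.subset_univ (insert F _)), add_mul] at h2
      refine (Submodule.add_mem_iff_right _ ?_).1 h2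
      rw [Finset.sum_mul]
      refine sum_mem fun H hH => relIdeal_le_relIdealTotal ?_
      simp only [Finset.mem_sdiff, Finset.mem_univ, true_and, Finset.mem_insert, not_or] at hH
      obtain ⟨hHF, hH⟩ := hH
      by_cases hsub : H ⊆ F
      · obtain ⟨K, -, rfl⟩ := Finset.subset_map_iff.1 hsub
        refine absurd (Finset.mem_map.2 ⟨K, ?_, rfl⟩) hH
        simp only [Finset.mem_filter, Finset.mem_univ, true_and]
        rintro rfl
        exact hHF rfl
      · by_cases hsub' : F ⊆ H
        · refine Ideal.mul_mem_right _ _ (IsRel.large H ?_).mem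
          have : F.card < H.card := Finset.card_lt_card ⟨hsub', hsub⟩
          simpa [hF] using this
        · exact (IsRel.incomp H F hsub hsub').mem
    · obtain ⟨K, -, rfl⟩ := Finset.subset_map_iff.1 hGF
      refine ⟨X K, isHomogeneous_X _ _, ?_⟩
      rw [restrictHom_X e (by rintro rfl; exact hEq rfl), sub_self]
      exact zero_mem _
  · refine ⟨0, zero_mem _, ?_⟩
    rw [map_zero, zero_mul, sub_zero]
    refine relIdeal_le_relIdealTotal ?_
    by_cases hsub' : F ⊆ G
    · refine Ideal.mul_mem_right _ _ (IsRel.large G ?_).mem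
      have : F.card < G.card := Finset.card_lt_card ⟨hsub', hGF⟩
      simpa [hF] using this
    · exact (IsRel.incomp G F hGF hsub').mem

theorem relIdealTotal_sup_span_large :
    relIdealTotal c n (k + 1) ⊔ Ideal.span (Set.range fun F : {F : Finset (Fin n) // F.card = k} =>
      (X F.1 : MvPolynomial (Finset (Fin n)) ℚ)) ≤ relIdealTotal c n k := by
  refine sup_le (sup_le (Ideal.span_le.2 ?_) le_sup_right) (Ideal.span_le.2 ?_)
  · rintro p hp
    refine relIdeal_le_relIdealTotal ?_
    cases hp with
    | large G h => exact (IsRel.large G (by omega)).mem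
    | incomp F G h h' => exact (IsRel.incomp F G h h').mem
    | aug F i h => exact (IsRel.aug F i h).mem
    | chow i h => exact (IsRel.chow i h).mem
    | unit h hk => omega
  · rintro _ ⟨F, rfl⟩
    exact relIdeal_le_relIdealTotal (IsRel.large F.1 F.2.ge).mem

theorem relIdealTotal_le_sup_span_large (hk : 0 < k) :
    relIdealTotal c n k ≤ relIdealTotal c n (k + 1) ⊔
      Ideal.span (Set.range fun F : {F : Finset (Fin n) // F.card = k} =>
        (X F.1 : MvPolynomial (Finset (Fin n)) ℚ)) := by
  refine sup_le (Ideal.span_le.2 ?_) (le_sup_of_le_left le_sup_right)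
  rintro p hp
  cases hp with
  | large G h =>
    rcases h.eq_or_lt with h | h
    · exact Ideal.mem_sup_right (Ideal.subset_span ⟨⟨G, h.symm⟩, rfl⟩)
    · exact Ideal.mem_sup_left (relIdeal_le_relIdealTotal (IsRel.large G h).mem)
  | incomp F G h h' =>
    exact Ideal.mem_sup_left (relIdeal_le_relIdealTotal (IsRel.incomp F G h h').mem)
  | aug F i h => exact Ideal.mem_sup_left (relIdeal_le_relIdealTotal (IsRel.aug F i h).mem)
  | chow i h => exact Ideal.mem_sup_left (relIdeal_le_relIdealTotal (IsRel.chow i h).mem)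
  | unit h hk => omega

theorem relIdealTotal_eq_sup_span_large (hk : 0 < k) :
    relIdealTotal c n (k + 1) ⊔ Ideal.span (Set.range fun F : {F : Finset (Fin n) // F.card = k} =>
      (X F.1 : MvPolynomial (Finset (Fin n)) ℚ)) = relIdealTotal c n k :=
  le_antisymm relIdealTotal_sup_span_large (relIdealTotal_le_sup_span_large hk)

/-- Once `∑_G x_G` is killed, the principal ideal of a flat `F` of corank one is a shifted quotient
of the ring of `U_{k-1,k}`, where `k = |F|`. -/
theorem hilbertFn_relIdealTotal_succ_le (hk : 0 < k) (j : ℕ) :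
    hilbertFn (relIdealTotal c n (k + 1)) (j + 1) ≤
      hilbertFn (relIdealTotal c n k) (j + 1) +
        n.choose k * hilbertFn (relIdeal c k (k - 1)) j := by
  refine (hilbertFn_succ_le isGradedIdeal_relIdealTotal
    (fun F : {F : Finset (Fin n) // F.card = k} => X F.1)
    (fun _ => isHomogeneous_X _ _) j).trans ?_
  rw [relIdealTotal_eq_sup_span_large hk]
  refine Nat.add_le_add_left ((Finset.sum_le_card_nsmul _ _
    (hilbertFn (relIdeal c k (k - 1)) j) fun F _ => ?_).trans ?_) _
  · have hF : F.1 = Finset.univ.map (F.1.orderEmbOfFin F.2).toEmbedding := by simp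
    rw [hF]
    exact finrank_mulDegreePart_le _ _ (restrictHom _) _
      (fun p hp => restrictHom_mul_mem hk _ hp) (exists_X_mul_sub_restrictHom_mem _) j
  · rw [smul_eq_mul, Finset.card_univ, Fintype.card_finset_len, Fintype.card_fin]

theorem hilbertFn_relIdealTotal_zero_le (hk : 0 < k) :
    hilbertFn (relIdealTotal c n (k + 1)) 0 ≤ hilbertFn (relIdealTotal c n k) 0 := by
  refine (hilbertFn_zero_le isGradedIdeal_relIdealTotal
    (fun F : {F : Finset (Fin n) // F.card = k} => X F.1)
    (fun _ => isHomogeneous_X _ _)).trans ?_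
  rw [relIdealTotal_eq_sup_span_large hk]

end Presentation

/-! ### Lower bounds from finite sets of points -/

section OrbitHarmonics

open Matroid

variable {σ ι : Type*}

/-- Simultaneous evaluation at the points `pt i`. -/
noncomputable def evalPoints (pt : ι → σ → ℚ) : MvPolynomial σ ℚ →ₐ[ℚ] (ι → ℚ) :=
  AlgHom.pi fun i => MvPolynomial.aeval (pt i)

theorem evalPoints_apply (pt : ι → σ → ℚ) (p : MvPolynomial σ ℚ) (i : ι) :
    evalPoints pt p i = MvPolynomial.aeval (pt i) p := rfl

/-- The functions on the points `pt i` that are represented by polynomials of degree less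
than `m`. -/
noncomputable def lowDegree (pt : ι → σ → ℚ) (m : ℕ) : Submodule ℚ (ι → ℚ) :=
  (Finset.range m).sup fun j =>
    (MvPolynomial.homogeneousSubmodule σ ℚ j).map (evalPoints pt).toLinearMap

theorem lowDegree_mono (pt : ι → σ → ℚ) {l m : ℕ} (h : l ≤ m) :
    lowDegree pt l ≤ lowDegree pt m :=
  Finset.sup_mono (Finset.range_subset_range.2 h)

theorem lowDegree_succ (pt : ι → σ → ℚ) (m : ℕ) :
    lowDegree pt (m + 1) =
      (MvPolynomial.homogeneousSubmodule σ ℚ m).map (evalPoints pt).toLinearMap ⊔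
        lowDegree pt m := by
  rw [lowDegree, Finset.range_add_one, Finset.sup_insert, lowDegree]

theorem evalPoints_mem_lowDegree (pt : ι → σ → ℚ) {d m : ℕ} (h : d < m) {p : MvPolynomial σ ℚ}
    (hp : p ∈ MvPolynomial.homogeneousSubmodule σ ℚ d) : evalPoints pt p ∈ lowDegree pt m :=
  Finset.le_sup (f := fun j =>
    (MvPolynomial.homogeneousSubmodule σ ℚ j).map (evalPoints pt).toLinearMap)
    (Finset.mem_range.2 h) ⟨p, hp, rfl⟩

theorem evalPoints_mul_mem_lowDegree (pt : ι → σ → ℚ) {d m : ℕ} {p : MvPolynomial σ ℚ}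
    (hp : p ∈ MvPolynomial.homogeneousSubmodule σ ℚ d) {v : ι → ℚ} (hv : v ∈ lowDegree pt m) :
    evalPoints pt p * v ∈ lowDegree pt (d + m) := by
  have : lowDegree pt m ≤ (lowDegree pt (d + m)).comap
      (LinearMap.mulLeft ℚ (evalPoints pt p)) := by
    refine Finset.sup_le fun j hj => ?_
    rintro _ ⟨q, hq, rfl⟩
    change evalPoints pt p * evalPoints pt q ∈ lowDegree pt (d + m)
    rw [← map_mul]
    exact evalPoints_mem_lowDegree pt (by simpa using hj) (hp.mul hq)
  exact this hv

theorem evalPoints_mem_lowDegree_of_totalDegree_lt (pt : ι → σ → ℚ) {m : ℕ}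
    {p : MvPolynomial σ ℚ} (hp : p.totalDegree < m) : evalPoints pt p ∈ lowDegree pt m := by
  rw [← MvPolynomial.sum_homogeneousComponent p, map_sum]
  refine sum_mem fun i hi => evalPoints_mem_lowDegree pt ?_
    (MvPolynomial.homogeneousComponent_mem i p)
  have := Finset.mem_range.1 hi
  omega

/-- Polynomials separate finitely many distinct points. -/
theorem exists_evalPoints_eq_single [Fintype ι] [DecidableEq ι] {pt : ι → σ → ℚ}
    (hpt : Function.Injective pt) (i : ι) : ∃ p, evalPoints pt p = Pi.single i 1 := by
  have hex : ∀ j : ι, ∃ q : MvPolynomial σ ℚ, MvPolynomial.aeval (pt i) q = 1 ∧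
      (j ≠ i → MvPolynomial.aeval (pt j) q = 0) := by
    intro j
    by_cases h : j = i
    · exact ⟨1, map_one _, fun h' => absurd h h'⟩
    · obtain ⟨s, hs⟩ := Function.ne_iff.1 fun h' => h (hpt h')
      refine ⟨MvPolynomial.C (pt i s - pt j s)⁻¹ *
        (MvPolynomial.X s - MvPolynomial.C (pt j s)), ?_, fun _ => ?_⟩
      · have : pt i s - pt j s ≠ 0 := sub_ne_zero.2 hs.symm
        simp [this]
      · simp
  choose q hq1 hq0 using hex
  refine ⟨∏ j, q j, funext fun l => ?_⟩
  rw [evalPoints_apply, map_prod]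
  by_cases hl : l = i
  · subst hl
    simp [hq1]
  · rw [Pi.single_eq_of_ne hl]
    exact Finset.prod_eq_zero (Finset.mem_univ l) (hq0 l hl)

theorem lowDegree_eq_top [Fintype ι] {pt : ι → σ → ℚ} (hpt : Function.Injective pt) :
    ∃ m, lowDegree pt m = ⊤ := by
  classical
  choose p hp using exists_evalPoints_eq_single hpt
  refine ⟨(Finset.univ.sup fun i => (p i).totalDegree) + 1, eq_top_iff.2 fun v _ => ?_⟩
  rw [pi_eq_sum_univ' v]
  refine sum_mem fun i _ => Submodule.smul_mem _ _ ?_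
  rw [← hp i]
  exact evalPoints_mem_lowDegree_of_totalDegree_lt pt (Nat.lt_succ_of_le
    (Finset.le_sup (f := fun i => (p i).totalDegree) (Finset.mem_univ i)))

theorem evalPoints_homogeneousComponent_mem {pt : ι → σ → ℚ} {s : Set (MvPolynomial σ ℚ)}
    (hs : ∀ g ∈ s, ∃ d, g ∈ MvPolynomial.homogeneousSubmodule σ ℚ d ∧
      evalPoints pt g ∈ lowDegree pt d) {p : MvPolynomial σ ℚ} (hp : p ∈ Ideal.span s) (j : ℕ) :
    evalPoints pt (MvPolynomial.homogeneousComponent j p) ∈ lowDegree pt j := by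
  refine Submodule.span_induction (p := fun p _ => ∀ j,
    evalPoints pt (MvPolynomial.homogeneousComponent j p) ∈ lowDegree pt j) ?_ ?_ ?_ ?_ hp j
  · intro g hg j
    obtain ⟨d, hd, hgd⟩ := hs g hg
    rw [MvPolynomial.homogeneousComponent_of_mem hd]
    split_ifs with h
    · exact h ▸ hgd
    · simp
  · simp
  · intro x y _ _ hx hy j
    rw [map_add, map_add]
    exact add_mem (hx j) (hy j)
  · intro a x _ hx j
    rw [smul_eq_mul, ← MvPolynomial.sum_homogeneousComponent a, Finset.sum_mul, map_sum, map_sum]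
    refine sum_mem fun i _ => ?_
    have hi := MvPolynomial.homogeneousComponent_mem i a
    rw [mul_comm]
    rcases lt_or_ge j i with h | h
    · rw [homogeneousComponent_mul_eq_zero_of_lt hi _ h, map_zero]
      exact zero_mem _
    · obtain ⟨l, rfl⟩ := Nat.exists_eq_add_of_le' h
      rw [homogeneousComponent_mul_of_mem hi, map_mul, mul_comm, add_comm]
      exact evalPoints_mul_mem_lowDegree pt hi (hx l)

theorem finrank_map_le_finrank_map {V₁ V₂ V₃ : Type*} [AddCommGroup V₁] [Module ℚ V₁]
    [AddCommGroup V₂] [Module ℚ V₂] [AddCommGroup V₃] [Module ℚ V₃] (U : Submodule ℚ V₁)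
    [FiniteDimensional ℚ U] (f : V₁ →ₗ[ℚ] V₂) (g : V₁ →ₗ[ℚ] V₃)
    (h : ∀ x ∈ U, g x = 0 → f x = 0) :
    Module.finrank ℚ (U.map f) ≤ Module.finrank ℚ (U.map g) := by
  have hf := (f.domRestrict U).finrank_range_add_finrank_ker
  have hg := (g.domRestrict U).finrank_range_add_finrank_ker
  rw [LinearMap.range_domRestrict] at hf hg
  have : Module.finrank ℚ (LinearMap.ker (g.domRestrict U)) ≤
      Module.finrank ℚ (LinearMap.ker (f.domRestrict U)) :=
    Submodule.finrank_mono fun x hx => h x.1 x.2 hx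
  omega

theorem finrank_sup_le_add_finrank_map_mkQ {V : Type*} [AddCommGroup V] [Module ℚ V]
    [FiniteDimensional ℚ V] (A B : Submodule ℚ V) :
    Module.finrank ℚ (A ⊔ B : Submodule ℚ V) ≤
      Module.finrank ℚ B + Module.finrank ℚ (A.map B.mkQ) := by
  have h := (B.mkQ.domRestrict (A ⊔ B)).finrank_range_add_finrank_ker
  have hr : LinearMap.range (B.mkQ.domRestrict (A ⊔ B)) = A.map B.mkQ := by
    rw [LinearMap.range_domRestrict, Submodule.map_sup, Submodule.mkQ_map_self, sup_bot_eq]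
  have hk : Module.finrank ℚ (LinearMap.ker (B.mkQ.domRestrict (A ⊔ B))) ≤
      Module.finrank ℚ B := by
    rw [← Submodule.finrank_map_subtype_eq]
    refine Submodule.finrank_mono ?_
    rintro _ ⟨x, hx, rfl⟩
    exact (Submodule.Quotient.mk_eq_zero B).1 hx
  rw [hr] at h
  omega

theorem finrank_lowDegree_succ_le [Finite σ] [Finite ι] {pt : ι → σ → ℚ}
    {s : Set (MvPolynomial σ ℚ)}
    (hs : ∀ g ∈ s, ∃ d, g ∈ MvPolynomial.homogeneousSubmodule σ ℚ d ∧
      evalPoints pt g ∈ lowDegree pt d) (m : ℕ) :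
    Module.finrank ℚ (lowDegree pt (m + 1)) ≤
      Module.finrank ℚ (lowDegree pt m) + hilbertFn (Ideal.span s) m := by
  rw [lowDegree_succ]
  refine (finrank_sup_le_add_finrank_map_mkQ _ _).trans (Nat.add_le_add_left ?_ _)
  rw [← Submodule.map_comp]
  refine finrank_map_le_finrank_map _ _ _ fun p hp h => ?_
  have hp' : p ∈ Ideal.span s := Ideal.Quotient.eq_zero_iff_mem.1 h
  refine (Submodule.Quotient.mk_eq_zero _).2 ?_
  have := evalPoints_homogeneousComponent_mem hs hp' m
  rwa [MvPolynomial.homogeneousComponent_eq_self hp] at this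

/-- If every generator of a homogeneous ideal agrees, on a finite set of points, with a polynomial
of smaller degree, then the quotient by the ideal has dimension at least the number of points. -/
theorem exists_card_le_sum_hilbertFn [Finite σ] [Fintype ι] {pt : ι → σ → ℚ}
    (hpt : Function.Injective pt) {s : Set (MvPolynomial σ ℚ)}
    (hs : ∀ g ∈ s, ∃ d, g ∈ MvPolynomial.homogeneousSubmodule σ ℚ d ∧
      evalPoints pt g ∈ lowDegree pt d) :
    ∃ m, ∀ l, m ≤ l → Fintype.card ι ≤ ∑ j ∈ Finset.range l, hilbertFn (Ideal.span s) j := by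
  obtain ⟨m, hm⟩ := lowDegree_eq_top hpt
  refine ⟨m, fun l hl => ?_⟩
  have key : ∀ l, Module.finrank ℚ (lowDegree pt l) ≤
      ∑ j ∈ Finset.range l, hilbertFn (Ideal.span s) j := by
    intro l
    induction l with
    | zero => simp [show lowDegree pt 0 = ⊥ from Finset.sup_empty]
    | succ l ih =>
      rw [Finset.sum_range_succ]
      exact (finrank_lowDegree_succ_le hs l).trans (by gcongr)
  have htop : lowDegree pt l = ⊤ := eq_top_iff.2 (hm ▸ lowDegree_mono pt hl)
  have := key l
  rwa [htop, finrank_top, Module.finrank_fintype_fun_eq_card] at this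

end OrbitHarmonics

/-! ### The points attached to flags of subsets -/

section FixedPoints

variable {n j : ℕ}

/-- The value `i + 1` attached to the `m`-th entry `i` of the sequence `e`, shifted by one so
that index zero gives `0`. -/
noncomputable def seqValue (e : Fin j ↪ Fin n) : ℕ → ℚ
  | 0 => 0
  | m + 1 => if h : m < j then (e ⟨m, h⟩ : ℚ) + 1 else 0

/-- The complement of `{e l, e (l + 1), …}`. These sets, for `l < j`, form a maximal chain above
the complement of the range of `e`. -/
def flagSet (e : Fin j ↪ Fin n) (l : ℕ) : Finset (Fin n) :=
  Finset.univ.filter fun i => ∀ m : Fin j, l ≤ m → e m ≠ i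

/-- The point supported on the flag of `e` at which `∑_{G ∌ i} x_G` takes the value `i + 1` if `i`
is in the range of `e`, and `0` otherwise. -/
noncomputable def flagPoint (e : Fin j ↪ Fin n) (G : Finset (Fin n)) : ℚ :=
  ∑ l ∈ Finset.range j, if flagSet e l = G then seqValue e (l + 1) - seqValue e l else 0

theorem mem_flagSet_apply_iff (e : Fin j ↪ Fin n) (l : ℕ) (m : Fin j) :
    e m ∈ flagSet e l ↔ (m : ℕ) < l := by
  simp only [flagSet, Finset.mem_filter, Finset.mem_univ, true_and]
  constructor
  · intro h
    by_contra! hlm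
    exact h m hlm rfl
  · intro h m' hm' he
    rw [e.injective he] at hm'
    omega

theorem mem_flagSet_of_notMem_range (e : Fin j ↪ Fin n) (l : ℕ) {i : Fin n}
    (hi : i ∉ Set.range e) : i ∈ flagSet e l := by
  simp only [flagSet, Finset.mem_filter, Finset.mem_univ, true_and]
  exact fun m _ he => hi ⟨m, he⟩

theorem flagSet_mono (e : Fin j ↪ Fin n) {l m : ℕ} (h : l ≤ m) : flagSet e l ⊆ flagSet e m := by
  intro i
  simp only [flagSet, Finset.mem_filter, Finset.mem_univ, true_and]
  exact fun hi p hp => hi p (h.trans hp)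

theorem flagSet_injOn (e : Fin j ↪ Fin n) : Set.InjOn (flagSet e) (Finset.range j) := by
  intro l hl m hm h
  simp only [Finset.coe_range, Set.mem_Iio] at hl hm
  have h1 := mem_flagSet_apply_iff e l ⟨m, hm⟩
  have h2 := mem_flagSet_apply_iff e m ⟨l, hl⟩
  rw [h, mem_flagSet_apply_iff] at h1
  rw [← h, mem_flagSet_apply_iff] at h2
  simp only at h1 h2
  omega

theorem seqValue_sub_ne_zero (e : Fin j ↪ Fin n) {l : ℕ} (hl : l < j) :
    seqValue e (l + 1) - seqValue e l ≠ 0 := by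
  rw [sub_ne_zero]
  cases l with
  | zero =>
    simp only [seqValue, hl, dite_true]
    positivity
  | succ l =>
    have hl' : l < j := by omega
    simp only [seqValue, hl, hl', dite_true]
    intro h
    have h' : (e ⟨l + 1, hl⟩ : ℚ) = (e ⟨l, hl'⟩ : ℚ) := by linarith
    have := e.injective (Fin.ext (by exact_mod_cast h'))
    simp at this

theorem flagPoint_flagSet (e : Fin j ↪ Fin n) {l : ℕ} (hl : l < j) :
    flagPoint e (flagSet e l) = seqValue e (l + 1) - seqValue e l := by
  rw [flagPoint, Finset.sum_eq_single_of_mem l (Finset.mem_range.2 hl), if_pos rfl]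
  intro m hm hml
  exact if_neg fun h => hml (flagSet_injOn e hm (Finset.mem_coe.2 (Finset.mem_range.2 hl)) h)

theorem exists_flagSet_eq (e : Fin j ↪ Fin n) {G : Finset (Fin n)} (h : flagPoint e G ≠ 0) :
    ∃ l < j, flagSet e l = G := by
  obtain ⟨l, hl, hne⟩ := Finset.exists_ne_zero_of_sum_ne_zero h
  exact ⟨l, Finset.mem_range.1 hl, by by_contra h'; exact hne (if_neg h')⟩

theorem sum_flagPoint (e : Fin j ↪ Fin n) (s : Finset (Finset (Fin n))) :
    ∑ G ∈ s, flagPoint e G =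
      ∑ l ∈ Finset.range j, if flagSet e l ∈ s then seqValue e (l + 1) - seqValue e l else 0 := by
  unfold flagPoint
  rw [Finset.sum_comm]
  exact Finset.sum_congr rfl fun l _ => Finset.sum_ite_eq _ _ _

theorem aeval_avoidForm_apply (e : Fin j ↪ Fin n) (m : Fin j) :
    MvPolynomial.aeval (flagPoint e) (avoidForm (e m)) = ((e m : ℕ) : ℚ) + 1 := by
  rw [avoidForm, map_sum]
  simp_rw [MvPolynomial.aeval_X]
  rw [sum_flagPoint, ← Finset.sum_filter]
  have hset : (Finset.range j).filter
      (fun l => flagSet e l ∈ Finset.univ.filter fun G => e m ∉ G) =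
      Finset.range ((m : ℕ) + 1) := by
    ext l
    have := m.2
    simp only [Finset.mem_filter, Finset.mem_range, Finset.mem_univ, true_and,
      mem_flagSet_apply_iff]
    omega
  rw [hset, Finset.sum_range_sub]
  simp [seqValue]

theorem aeval_avoidForm_of_notMem_range (e : Fin j ↪ Fin n) {i : Fin n} (hi : i ∉ Set.range e) :
    MvPolynomial.aeval (flagPoint e) (avoidForm i) = 0 := by
  rw [avoidForm, map_sum]
  refine Finset.sum_eq_zero fun G hG => ?_
  rw [MvPolynomial.aeval_X]
  by_contra h
  obtain ⟨l, -, rfl⟩ := exists_flagSet_eq e h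
  exact (Finset.mem_filter.1 hG).2 (mem_flagSet_of_notMem_range e l hi)

theorem mem_range_iff_aeval_avoidForm_ne_zero (e : Fin j ↪ Fin n) (i : Fin n) :
    i ∈ Set.range e ↔ MvPolynomial.aeval (flagPoint e) (avoidForm i) ≠ 0 := by
  constructor
  · rintro ⟨m, rfl⟩
    rw [aeval_avoidForm_apply]
    positivity
  · intro h
    by_contra h'
    exact h (aeval_avoidForm_of_notMem_range e h')

/-- The position of an entry of `e` is read off from the members of the flag that avoid it. -/
theorem card_flagPoint_ne_zero (e : Fin j ↪ Fin n) (m : Fin j) :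
    (Finset.univ.filter fun G => flagPoint e G ≠ 0 ∧ e m ∉ G).card = m + 1 := by
  have hm := m.2
  have : (Finset.univ.filter fun G => flagPoint e G ≠ 0 ∧ e m ∉ G) =
      (Finset.range ((m : ℕ) + 1)).image (flagSet e) := by
    ext G
    simp only [Finset.mem_filter, Finset.mem_univ, true_and, Finset.mem_image, Finset.mem_range]
    constructor
    · rintro ⟨h, hG⟩
      obtain ⟨l, hl, rfl⟩ := exists_flagSet_eq e h
      rw [mem_flagSet_apply_iff] at hG
      exact ⟨l, by omega, rfl⟩
    · rintro ⟨l, hl, rfl⟩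
      rw [mem_flagSet_apply_iff, flagPoint_flagSet e (by omega)]
      exact ⟨seqValue_sub_ne_zero e (by omega), by omega⟩
  rw [this, Finset.card_image_of_injOn, Finset.card_range]
  refine (flagSet_injOn e).mono ?_
  simp only [Finset.coe_range]
  exact Set.Iio_subset_Iio (by omega)

theorem flagPoint_injective :
    Function.Injective fun x : Σ j : Fin (n + 1), (Fin j ↪ Fin n) => flagPoint x.2 := by
  rintro ⟨j, e⟩ ⟨j', e'⟩ h
  simp only at h
  have hrange : Set.range e = Set.range e' := by
    ext i
    rw [mem_range_iff_aeval_avoidForm_ne_zero, h, ← mem_range_iff_aeval_avoidForm_ne_zero]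
  have hj : j = j' := by
    have h1 := congrArg Set.ncard hrange
    rw [← Set.image_univ, ← Set.image_univ, Set.ncard_image_of_injective _ e.injective,
      Set.ncard_image_of_injective _ e'.injective, Set.ncard_univ, Set.ncard_univ,
      Nat.card_eq_fintype_card, Nat.card_eq_fintype_card, Fintype.card_fin,
      Fintype.card_fin] at h1
    exact Fin.ext h1
  subst hj
  congr 1
  ext m : 1
  obtain ⟨m', hm'⟩ : e m ∈ Set.range e' := hrange ▸ Set.mem_range_self m
  have h1 := card_flagPoint_ne_zero e m
  have h2 := card_flagPoint_ne_zero e' m'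
  rw [hm', ← h, h1] at h2
  have : m = m' := Fin.ext (by omega)
  rw [← hm', this]

/-- The relations at `k = n`, evaluated at points of flags, have smaller degree than expected. -/
theorem IsRel.evalPoints_mem {c : Prop} {ι : Type*} (x : ι → Σ j : Fin (n + 1), (Fin j ↪ Fin n))
    (hn : c → 0 < n) (hx : c → ∀ i, ((x i).1 : ℕ) = n)
    {g : MvPolynomial (Finset (Fin n)) ℚ} (hg : IsRel c n n g) :
    ∃ d, g ∈ MvPolynomial.homogeneousSubmodule (Finset (Fin n)) ℚ d ∧
      evalPoints (fun i => flagPoint (x i).2) g ∈ lowDegree (fun i => flagPoint (x i).2) d := by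
  cases hg with
  | large G h =>
    refine ⟨1, MvPolynomial.isHomogeneous_X _ _, ?_⟩
    convert Submodule.zero_mem _ using 1
    funext i
    rw [evalPoints_apply, MvPolynomial.aeval_X]
    by_contra hne
    obtain ⟨l, hl, rfl⟩ := exists_flagSet_eq _ hne
    have huniv : flagSet (x i).2 l = Finset.univ :=
      (Finset.card_eq_iff_eq_univ _).1 (le_antisymm (Finset.card_le_univ _) (by simpa using h))
    have := mem_flagSet_apply_iff (x i).2 l ⟨l, hl⟩
    simp [huniv] at this
  | incomp F G h h' =>
    refine ⟨2, (MvPolynomial.isHomogeneous_X _ _).mul (MvPolynomial.isHomogeneous_X _ _), ?_⟩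
    convert Submodule.zero_mem _ using 1
    funext i
    rw [evalPoints_apply, map_mul, MvPolynomial.aeval_X, MvPolynomial.aeval_X]
    by_contra hne
    obtain ⟨l, hl, rfl⟩ := exists_flagSet_eq _ (left_ne_zero_of_mul hne)
    obtain ⟨m, hm, rfl⟩ := exists_flagSet_eq _ (right_ne_zero_of_mul hne)
    rcases le_total l m with hlm | hlm
    · exact h (flagSet_mono _ hlm)
    · exact h' (flagSet_mono _ hlm)
  | aug F i h =>
    refine ⟨2, (MvPolynomial.isHomogeneous_X _ _).mul (avoidForm_mem_homogeneous i), ?_⟩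
    have : evalPoints (fun i => flagPoint (x i).2) (MvPolynomial.X F * avoidForm i) =
        evalPoints (fun i => flagPoint (x i).2)
          (MvPolynomial.C ((i : ℚ) + 1) * MvPolynomial.X F) := by
      funext a
      rw [evalPoints_apply, evalPoints_apply, map_mul, map_mul, MvPolynomial.aeval_X,
        MvPolynomial.aeval_C]
      by_cases hF : flagPoint (x a).2 F = 0
      · simp [hF]
      · -- A member of the flag avoids `i`, so `i` is in the sequence and `y_i` is constant.
        obtain ⟨l, hl, rfl⟩ := exists_flagSet_eq _ hF
        obtain ⟨m, rfl⟩ : i ∈ Set.range (x a).2 := by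
          by_contra hi
          exact h (mem_flagSet_of_notMem_range _ _ hi)
        rw [aeval_avoidForm_apply, mul_comm]
        rfl
    rw [this]
    exact evalPoints_mem_lowDegree _ one_lt_two (MvPolynomial.isHomogeneous_C_mul_X _ _)
  | chow i h =>
    refine ⟨1, avoidForm_mem_homogeneous i, ?_⟩
    have : evalPoints (fun i => flagPoint (x i).2) (avoidForm i) =
        evalPoints (fun i => flagPoint (x i).2) (MvPolynomial.C ((i : ℚ) + 1)) := by
      funext a
      have hsurj : Function.Surjective (x a).2 :=
        ((Fintype.bijective_iff_injective_and_card _).2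
          ⟨(x a).2.injective, by simpa using hx h a⟩).2
      obtain ⟨m, rfl⟩ := hsurj i
      rw [evalPoints_apply, evalPoints_apply, aeval_avoidForm_apply, MvPolynomial.aeval_C]
      rfl
    rw [this]
    exact evalPoints_mem_lowDegree _ zero_lt_one (MvPolynomial.isHomogeneous_C _ _)
  | unit h hk => exact absurd hk (hn h).ne'

theorem exists_card_le_sum_hilbertFn_relIdeal {c : Prop} {ι : Type*} [Fintype ι]
    (x : ι → Σ j : Fin (n + 1), (Fin j ↪ Fin n)) (hinj : Function.Injective x)
    (hn : c → 0 < n) (hx : c → ∀ i, ((x i).1 : ℕ) = n) :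
    ∃ m, ∀ l, m ≤ l → Fintype.card ι ≤ ∑ j ∈ Finset.range l, hilbertFn (relIdeal c n n) j :=
  exists_card_le_sum_hilbertFn (flagPoint_injective.comp hinj)
    fun _ hg => IsRel.evalPoints_mem x hn hx hg

/-- In full rank the Chow ring has dimension at least the number of complete flags. -/
theorem exists_factorial_le_sum_hilbertFn {c : Prop} (hn : 0 < n) :
    ∃ m, ∀ l, m ≤ l → n.factorial ≤ ∑ j ∈ Finset.range l, hilbertFn (relIdeal c n n) j := by
  have := exists_card_le_sum_hilbertFn_relIdeal (c := c) (n := n)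
    (fun e : Fin n ↪ Fin n => ⟨Fin.last n, e⟩) (fun e e' h => by simpa using h)
    (fun _ => hn) (fun _ _ => rfl)
  rwa [Fintype.card_embedding_eq, Fintype.card_fin, Nat.descFactorial_self] at this

/-- In full rank the augmented Chow ring has dimension at least the number of injective
sequences. -/
theorem exists_sum_choose_mul_factorial_le_sum_hilbertFn {c : Prop} (hc : ¬ c) (n : ℕ) :
    ∃ m, ∀ l, m ≤ l → ∑ j ∈ Finset.range (n + 1), n.choose j * j.factorial ≤
      ∑ j ∈ Finset.range l, hilbertFn (relIdeal c n n) j := by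
  have := exists_card_le_sum_hilbertFn_relIdeal (c := c) (n := n) id Function.injective_id
    (fun h => absurd h hc) (fun h => absurd h hc)
  rw [Fintype.card_sigma] at this
  simp_rw [Fintype.card_embedding_eq, Fintype.card_fin, Nat.descFactorial_eq_factorial_mul_choose,
    mul_comm] at this
  rwa [Fin.sum_univ_eq_sum_range fun j => n.choose j * j.factorial] at this

end FixedPoints

/-! ### The Hilbert functions of the common presentation -/

section HilbertPolynomials

/-- The polynomial `∑_{j < k} (n choose j) e_j (1 + ⋯ + x^{k-1-j}) + ε x^k`. -/
noncomputable def chowPoly (ε : ℤ[X]) (e : ℕ → ℤ[X]) (n k : ℕ) : ℤ[X] :=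
  ∑ j ∈ Finset.range k, (n.choose j : ℤ[X]) * e j * ∑ i ∈ Finset.range (k - j), X ^ i + ε * X ^ k

/-- The polynomial `∑_{j < k} (n choose j) e_j`. -/
noncomputable def choosePoly (e : ℕ → ℤ[X]) (n k : ℕ) : ℤ[X] :=
  ∑ j ∈ Finset.range k, (n.choose j : ℤ[X]) * e j

variable {ε : ℤ[X]} {e : ℕ → ℤ[X]}

theorem choosePoly_succ (n k : ℕ) :
    choosePoly e n (k + 1) = choosePoly e n k + (n.choose k : ℤ[X]) * e k :=
  Finset.sum_range_succ _ _

theorem chowPoly_succ (n k : ℕ) :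
    chowPoly ε e n (k + 1) = choosePoly e n (k + 1) + X * chowPoly ε e n k := by
  have h : ∀ j ∈ Finset.range k, (n.choose j : ℤ[X]) * e j * ∑ i ∈ Finset.range (k + 1 - j), X ^ i =
      (n.choose j : ℤ[X]) * e j +
        X * ((n.choose j : ℤ[X]) * e j * ∑ i ∈ Finset.range (k - j), X ^ i) := by
    intro j hj
    have : k + 1 - j = (k - j) + 1 := by have := Finset.mem_range.1 hj; omega
    rw [this, Finset.sum_range_succ', pow_zero]
    simp_rw [pow_succ', ← Finset.mul_sum]
    ring
  rw [chowPoly, chowPoly, choosePoly, Finset.sum_range_succ, Finset.sum_congr rfl h,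
    Finset.sum_add_distrib, ← Finset.mul_sum, Finset.sum_range_succ _ k]
  simp only [Nat.add_sub_cancel_left, Finset.sum_range_one, pow_zero]
  ring

theorem hilbertFn_top {σ : Type*} (j : ℕ) : hilbertFn (⊤ : Ideal (MvPolynomial σ ℚ)) j = 0 := by
  have : Subsingleton (MvPolynomial σ ℚ ⧸ (⊤ : Ideal (MvPolynomial σ ℚ))) :=
    Ideal.Quotient.subsingleton_iff.2 rfl
  rw [hilbertFn]
  exact Module.finrank_zero_of_subsingleton

theorem hilbertFn_le_coeff_one {σ : Type*} {I : Ideal (MvPolynomial σ ℚ)}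
    (hI : ∀ s, MvPolynomial.X s ∈ I) (j : ℕ) : (hilbertFn I j : ℤ) ≤ (1 : ℤ[X]).coeff j := by
  cases j with
  | zero =>
    rw [coeff_one_zero, hilbertFn, Matroid.quotientDegreePart,
      MvPolynomial.homogeneousSubmodule_zero, Submodule.one_eq_span, Submodule.map_span,
      Set.image_singleton]
    exact_mod_cast (finrank_span_le_card _).trans (by simp)
  | succ j =>
    have : Matroid.quotientDegreePart I (j + 1) = ⊥ := by
      rw [eq_bot_iff]
      rintro _ ⟨p, hp, rfl⟩
      refine Ideal.Quotient.eq_zero_iff_mem.2 ?_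
      rw [SetLike.mem_coe, ← MvPolynomial.homogeneousSubmodule_one_pow, pow_succ] at hp
      refine Submodule.mul_induction_on hp (fun a _ b hb => ?_) fun a b => add_mem
      refine Ideal.mul_mem_left _ _ ?_
      have hle : MvPolynomial.homogeneousSubmodule σ ℚ 1 ≤ I.restrictScalars ℚ := by
        rw [MvPolynomial.homogeneousSubmodule_one_eq_span_X, Submodule.span_le]
        rintro _ ⟨s, rfl⟩
        exact hI s
      exact hle hb
    rw [hilbertFn, this, finrank_bot, coeff_one]
    simp

theorem X_mem_relIdealTotal_one {c : Prop} {n : ℕ} (G : Finset (Fin n)) :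
    MvPolynomial.X G ∈ relIdealTotal c n 1 := by
  have hlarge : ∀ H : Finset (Fin n), H ≠ ∅ → MvPolynomial.X H ∈ relIdealTotal c n 1 :=
    fun H hH => relIdeal_le_relIdealTotal
      (IsRel.large H (Finset.card_pos.2 (Finset.nonempty_iff_ne_empty.2 hH))).mem
  by_cases hG : G = ∅
  · have h := totalForm_mem (c := c) (n := n) (k := 1)
    rw [totalForm, ← Finset.sum_erase_add _ _ (Finset.mem_univ (∅ : Finset (Fin n)))] at h
    rw [hG]
    exact (Submodule.add_mem_iff_right _
      (sum_mem fun H hH => hlarge H (Finset.ne_of_mem_erase hH))).1 h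
  · exact hlarge G hG

/-- The constant term `ε` with which `chowPoly ε e` gives the Hilbert series: zero for the Chow
ring, one for the augmented Chow ring. -/
noncomputable def rankZeroPoly (c : Prop) : ℤ[X] :=
  open Classical in if c then 0 else 1

theorem hilbertFn_relIdeal_rank_zero_le (c : Prop) (n j : ℕ) :
    (hilbertFn (relIdeal c n 0) j : ℤ) ≤ (rankZeroPoly c).coeff j := by
  unfold rankZeroPoly
  split_ifs with hc
  · have : relIdeal c n 0 = ⊤ := (Ideal.eq_top_iff_one _).2 (IsRel.unit hc rfl).mem
    rw [this, hilbertFn_top]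
    simp
  · exact hilbertFn_le_coeff_one (fun G => (IsRel.large G (Nat.zero_le _)).mem) j

theorem choosePoly_one (he0 : e 0 = 1) (n : ℕ) : choosePoly e n 1 = 1 := by
  simp [choosePoly, he0]

variable {c : Prop}

/-- The upper bound on both families of Hilbert functions, by induction on the rank. -/
theorem hilbertFn_le_coeff (he0 : e 0 = 1)
    (he : ∀ j, e (j + 1) = X * chowPoly (rankZeroPoly c) e (j + 1) j) (k : ℕ) :
    ∀ n, k ≤ n →
      (0 < k → ∀ j, (hilbertFn (relIdealTotal c n k) j : ℤ) ≤ (choosePoly e n k).coeff j) ∧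
      ∀ j, (hilbertFn (relIdeal c n k) j : ℤ) ≤ (chowPoly (rankZeroPoly c) e n k).coeff j := by
  induction k using Nat.strong_induction_on with
  | _ k ih =>
  intro n hkn
  cases k with
  | zero =>
    refine ⟨fun h => absurd h (lt_irrefl _), fun j => ?_⟩
    simpa [chowPoly] using hilbertFn_relIdeal_rank_zero_le c n j
  | succ k =>
    have hK : ∀ j, (hilbertFn (relIdealTotal c n (k + 1)) j : ℤ) ≤
        (choosePoly e n (k + 1)).coeff j := by
      rcases Nat.eq_zero_or_pos k with rfl | hk
      · rw [choosePoly_one he0]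
        exact hilbertFn_le_coeff_one X_mem_relIdealTotal_one
      · obtain ⟨m, rfl⟩ : ∃ m, k = m + 1 := ⟨k - 1, by omega⟩
        have h1 := (ih (m + 1) (by omega) n (by omega)).1 hk
        have h2 := (ih m (by omega) (m + 1) (by omega)).2
        intro j
        rw [choosePoly_succ, he m, coeff_add, coeff_natCast_mul]
        cases j with
        | zero =>
          have := hilbertFn_relIdealTotal_zero_le (c := c) (n := n) hk
          have := h1 0
          rw [coeff_X_mul_zero]
          omega
        | succ j =>
          rw [coeff_X_mul]
          have h3 := hilbertFn_relIdealTotal_succ_le (c := c) (n := n) hk j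
          have h4 : ((n.choose (m + 1) : ℕ) : ℤ) * (hilbertFn (relIdeal c (m + 1) m) j : ℤ) ≤
              ((n.choose (m + 1) : ℕ) : ℤ) *
                (chowPoly (rankZeroPoly c) e (m + 1) m).coeff j :=
            mul_le_mul_of_nonneg_left (h2 j) (by positivity)
          have h5 := h1 (j + 1)
          rw [Nat.add_sub_cancel] at h3
          zify at h3
          linarith
    refine ⟨fun _ => hK, fun j => ?_⟩
    have h2 := (ih k (by omega) n (by omega)).2
    rw [chowPoly_succ, coeff_add]
    cases j with
    | zero =>
      have := hilbertFn_relIdeal_zero_le (c := c) (n := n) (k := k + 1)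
      have := hK 0
      rw [coeff_X_mul_zero]
      omega
    | succ j =>
      rw [coeff_X_mul]
      have h3 := hilbertFn_relIdeal_succ_le (c := c) (Nat.lt_of_succ_le hkn) j
      have := hK (j + 1)
      have := h2 j
      omega

/-- The upper bound is attained: at `k = n` by the count of points, and then in lower rank
because the ring of the truncation has to fill the ideal of `∑_G x_G`. -/
theorem hilbertFn_relIdeal_eq_coeff (he0 : e 0 = 1)
    (he : ∀ j, e (j + 1) = X * chowPoly (rankZeroPoly c) e (j + 1) j) {n N : ℕ}
    (hN : ∃ m, ∀ l, m ≤ l → N ≤ ∑ j ∈ Finset.range l, hilbertFn (relIdeal c n n) j)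
    (heval : (chowPoly (rankZeroPoly c) e n n).eval 1 = N) (m : ℕ) :
    ∀ k, k + m = n → ∀ j,
      (hilbertFn (relIdeal c n k) j : ℤ) = (chowPoly (rankZeroPoly c) e n k).coeff j := by
  induction m with
  | zero =>
    rintro k rfl j
    simp only [add_zero] at *
    obtain ⟨m, hm⟩ := hN
    set P := chowPoly (rankZeroPoly c) e k k with hP
    set l := m + (P.natDegree + 1) + (j + 1)
    have h1 := hm l (by omega)
    have h2 : P.eval 1 = ∑ j ∈ Finset.range l, P.coeff j := by
      rw [eval_eq_sum_range' (show P.natDegree < l by omega)]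
      simp
    have hle := (hilbertFn_le_coeff he0 he k k le_rfl).2
    have h3 : ∑ j ∈ Finset.range l, (hilbertFn (relIdeal c k k) j : ℤ) =
        ∑ j ∈ Finset.range l, P.coeff j := by
      refine le_antisymm (Finset.sum_le_sum fun i _ => hle i) ?_
      rw [← h2, heval]
      exact_mod_cast h1
    exact (Finset.sum_eq_sum_iff_of_le fun i _ => hle i).1 h3 j
      (Finset.mem_range.2 (by omega))
  | succ m ih =>
    intro k hk j
    have h1 := ih (k + 1) (by omega) (j + 1)
    have h2 := hilbertFn_relIdeal_succ_le (c := c) (show k < n by omega) j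
    have h3 := (hilbertFn_le_coeff he0 he (k + 1) n (by omega)).1 (by omega) (j + 1)
    have h4 := (hilbertFn_le_coeff he0 he k n (by omega)).2 j
    rw [chowPoly_succ, coeff_add, coeff_X_mul] at h1
    omega

end HilbertPolynomials

/-! ### Descents and excedances -/

section Eulerian

/-- The operator on polynomials by which a permutation statistic changes when a new letter may be
inserted in `n + 1` places: `x^s` is sent to `(s + 1) x^s + (n - s) x^{s+1}`. -/
noncomputable def insertOp (n : ℕ) (P : ℤ[X]) : ℤ[X] :=
  (1 + (n : ℤ[X]) * X) * P + (X - X ^ 2) * derivative P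

theorem insertOp_sum {ι : Type*} (s : Finset ι) (n : ℕ) (f : ι → ℤ[X]) :
    insertOp n (∑ i ∈ s, f i) = ∑ i ∈ s, insertOp n (f i) := by
  simp only [insertOp, derivative_sum, Finset.mul_sum, Finset.sum_add_distrib]

/-- Of `n + 1` insertions, one keeps the statistic `d`, as do those at the `d` places of `s`, and the
others raise it by one. -/
theorem sum_X_pow_insert {n d : ℕ} (s : Finset (Fin n)) (f : Fin n → ℕ) (hd : s.card = d)
    (hf : ∀ q, f q + (if q ∈ s then 1 else 0) = d + 1) :
    (X : ℤ[X]) ^ d + ∑ q, X ^ f q = insertOp n (X ^ d) := by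
  have h1 : ∀ q, (X : ℤ[X]) ^ f q = if q ∈ s then X ^ d else X ^ (d + 1) := by
    intro q
    have := hf q
    split_ifs at this ⊢
    · congr 1; omega
    · congr 1
  have h2 : (sᶜ.card : ℤ[X]) = (n : ℤ[X]) - d := by
    rw [Finset.card_compl, Fintype.card_fin, Nat.cast_sub, hd]
    simpa using Finset.card_le_univ s
  have h3 : (X - X ^ 2 : ℤ[X]) * derivative ((X : ℤ[X]) ^ d) =
      (d : ℤ[X]) * X ^ d - (d : ℤ[X]) * X ^ (d + 1) := by
    cases d with
    | zero => simp
    | succ d =>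
      rw [derivative_X_pow]
      simp only [Nat.add_sub_cancel, map_natCast]
      ring
  simp_rw [h1]
  rw [Finset.sum_ite]
  have e1 : Finset.univ.filter (fun q => q ∈ s) = s := by ext; simp
  have e2 : Finset.univ.filter (fun q => q ∉ s) = sᶜ := by ext; simp
  rw [e1, e2, Finset.sum_const, Finset.sum_const, nsmul_eq_mul, nsmul_eq_mul, h2, hd, insertOp, h3]
  ring

/-- The values of `τ`, shifted by one, as a sequence that ends with a large value. -/
def permSeq {n : ℕ} (τ : Equiv.Perm (Fin n)) (i : ℕ) : ℕ :=
  if h : i < n then (τ ⟨i, h⟩ : ℕ) + 1 else n + 1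

theorem permDescents_eq_sum {n : ℕ} (τ : Equiv.Perm (Fin n)) :
    permDescents τ =
      ∑ i ∈ Finset.range n, if permSeq τ (i + 1) < permSeq τ i then 1 else 0 := by
  rw [permDescents, Finset.card_filter, ← Fin.sum_univ_eq_sum_range
    (fun i => if permSeq τ (i + 1) < permSeq τ i then 1 else 0)]
  refine Finset.sum_congr rfl fun i _ => if_congr ?_ rfl rfl
  have hi := (τ i).2
  unfold permSeq
  rw [dif_pos i.2]
  split_ifs with h
  · simp [h]
  · simp only [h, false_iff, not_lt, IsEmpty.exists_iff]
    omega

/-- The permutation of `Fin (n + 1)` obtained from the word of `τ` by inserting a new smallest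
letter at position `p`. -/
def insertMin {n : ℕ} (p : Fin (n + 1)) (τ : Equiv.Perm (Fin n)) : Equiv.Perm (Fin (n + 1)) :=
  Equiv.Perm.decomposeFin.symm (0, τ) * p.cycleRange

theorem insertMin_self {n : ℕ} (p : Fin (n + 1)) (τ : Equiv.Perm (Fin n)) :
    insertMin p τ p = 0 := by
  rw [insertMin, Equiv.Perm.mul_apply, Fin.cycleRange_self,
    Equiv.Perm.decomposeFin_symm_apply_zero]

theorem insertMin_succAbove {n : ℕ} (p : Fin (n + 1)) (τ : Equiv.Perm (Fin n)) (i : Fin n) :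
    insertMin p τ (p.succAbove i) = (τ i).succ := by
  rw [insertMin, Equiv.Perm.mul_apply, Fin.cycleRange_succAbove,
    Equiv.Perm.decomposeFin_symm_apply_succ, Equiv.swap_self, Equiv.refl_apply]

theorem insertMin_bijective (n : ℕ) :
    Function.Bijective fun x : Fin (n + 1) × Equiv.Perm (Fin n) => insertMin x.1 x.2 := by
  rw [Fintype.bijective_iff_injective_and_card]
  refine ⟨?_, by simp [Fintype.card_perm, Nat.factorial_succ]⟩
  rintro ⟨p, τ⟩ ⟨p', τ'⟩ h
  simp only at h
  have hp : p = p' := by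
    apply (insertMin p τ).injective
    rw [insertMin_self, h, insertMin_self]
  subst hp
  congr 1
  ext i : 1
  have := insertMin_succAbove p τ i
  rw [h, insertMin_succAbove] at this
  exact (Fin.succ_injective _ this).symm

theorem permSeq_insertMin_of_lt {n : ℕ} {p : Fin (n + 1)} {τ : Equiv.Perm (Fin n)} {i : ℕ}
    (h : i < p) : permSeq (insertMin p τ) i = permSeq τ i + 1 := by
  have hp := p.2
  have hi : i < n := by omega
  have := insertMin_succAbove p τ ⟨i, hi⟩
  rw [Fin.succAbove_of_castSucc_lt _ _ (by simpa [Fin.lt_def] using h)] at this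
  unfold permSeq
  rw [dif_pos (show i < n + 1 by omega), dif_pos hi]
  have h2 : (⟨i, by omega⟩ : Fin (n + 1)) = Fin.castSucc ⟨i, hi⟩ := rfl
  rw [h2, this, Fin.val_succ]

theorem permSeq_insertMin_self {n : ℕ} (p : Fin (n + 1)) (τ : Equiv.Perm (Fin n)) :
    permSeq (insertMin p τ) p = 1 := by
  unfold permSeq
  rw [dif_pos p.2, Fin.eta, insertMin_self]
  simp

theorem permSeq_insertMin_of_le {n : ℕ} {p : Fin (n + 1)} {τ : Equiv.Perm (Fin n)} {i : ℕ}
    (h : p ≤ i) : permSeq (insertMin p τ) (i + 1) = permSeq τ i + 1 := by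
  unfold permSeq
  by_cases hi : i < n
  · have := insertMin_succAbove p τ ⟨i, hi⟩
    rw [Fin.succAbove_of_le_castSucc _ _ (by simpa [Fin.le_def] using h)] at this
    rw [dif_pos (show i + 1 < n + 1 by omega), dif_pos hi]
    have h2 : (⟨i + 1, by omega⟩ : Fin (n + 1)) = Fin.succ ⟨i, hi⟩ := rfl
    rw [h2, this, Fin.val_succ]
  · rw [dif_neg hi, dif_neg (by omega)]

theorem permSeq_pos {n : ℕ} (τ : Equiv.Perm (Fin n)) (i : ℕ) : 0 < permSeq τ i := by
  unfold permSeq; split_ifs <;> omega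

theorem permDescents_insertMin_zero {n : ℕ} (τ : Equiv.Perm (Fin n)) :
    permDescents (insertMin 0 τ) = permDescents τ := by
  have h0 : ∀ i, permSeq (insertMin 0 τ) (i + 1) = permSeq τ i + 1 :=
    fun i => permSeq_insertMin_of_le (Nat.zero_le _)
  have h1 : permSeq (insertMin 0 τ) 0 = 1 := permSeq_insertMin_self 0 τ
  rw [permDescents_eq_sum, permDescents_eq_sum, Finset.sum_range_succ', h1]
  simp [h0]

/-- Inserting the smallest letter right after position `q` creates a descent there, and destroys the
descent at `q` if there was one. -/
theorem permDescents_insertMin_succ {n : ℕ} (q : Fin n) (τ : Equiv.Perm (Fin n)) :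
    permDescents (insertMin q.succ τ) +
      (if q ∈ Finset.univ.filter (fun i : Fin n => ∃ h : i.val + 1 < n, τ ⟨i.val + 1, h⟩ < τ i)
        then 1 else 0) = permDescents τ + 1 := by
  have hdes : (q ∈ Finset.univ.filter fun i : Fin n =>
      ∃ h : i.val + 1 < n, τ ⟨i.val + 1, h⟩ < τ i) ↔ permSeq τ (q + 1) < permSeq τ q := by
    have hi := (τ q).2
    unfold permSeq
    rw [dif_pos q.2]
    split_ifs with h
    · simp [h]
    · simp only [Finset.mem_filter, h, IsEmpty.exists_iff, and_false, false_iff, not_lt]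
      omega
  rw [if_congr hdes rfl rfl]
  obtain ⟨q, hq⟩ := q
  obtain ⟨r, rfl⟩ : ∃ r, n = q + 1 + r := ⟨n - (q + 1), by omega⟩
  set σ := insertMin (Fin.succ ⟨q, hq⟩) τ
  have hlt : ∀ i, i < q + 1 → permSeq σ i = permSeq τ i + 1 :=
    fun i h => permSeq_insertMin_of_lt (by simpa using h)
  have hself : permSeq σ (q + 1) = 1 := permSeq_insertMin_self (Fin.succ ⟨q, hq⟩) τ
  have hge : ∀ i, q + 1 ≤ i → permSeq σ (i + 1) = permSeq τ i + 1 :=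
    fun i h => permSeq_insertMin_of_le (by simpa using h)
  rw [permDescents_eq_sum, permDescents_eq_sum,
    show Finset.range (q + 1 + r + 1) = Finset.range (q + 1 + 1 + r) by congr 1; omega,
    Finset.sum_range_add _ (q + 1 + 1),
    Finset.sum_range_add _ (q + 1) r, Finset.sum_range_succ _ (q + 1), Finset.sum_range_succ _ q,
    Finset.sum_range_succ _ q]
  have s1 : ∑ x ∈ Finset.range q, (if permSeq σ (x + 1) < permSeq σ x then 1 else 0) =
      ∑ x ∈ Finset.range q, if permSeq τ (x + 1) < permSeq τ x then 1 else 0 := by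
    refine Finset.sum_congr rfl fun x hx => ?_
    have := Finset.mem_range.1 hx
    rw [hlt x (by omega), hlt (x + 1) (by omega)]
    simp
  have s2 : ∑ x ∈ Finset.range r,
      (if permSeq σ (q + 1 + 1 + x + 1) < permSeq σ (q + 1 + 1 + x) then 1 else 0) =
      ∑ x ∈ Finset.range r,
        if permSeq τ (q + 1 + x + 1) < permSeq τ (q + 1 + x) then 1 else 0 := by
    refine Finset.sum_congr rfl fun x hx => ?_
    rw [show q + 1 + 1 + x = q + 1 + x + 1 by omega, hge _ (by omega), hge _ (by omega)]
    simp
  have s3 : (if permSeq σ (q + 1) < permSeq σ q then 1 else 0) = 1 := by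
    rw [hself, hlt q (by omega)]
    simp [permSeq_pos]
  have s4 : (if permSeq σ (q + 1 + 1) < permSeq σ (q + 1) then 1 else 0) = 0 := by
    rw [hself]
    have := permSeq_pos σ (q + 1 + 1)
    rw [if_neg (by omega)]
  rw [s1, s2, s3, s4]
  ring

theorem eulerianPoly_succ (n : ℕ) : eulerianPoly (n + 1) = insertOp n (eulerianPoly n) := by
  rw [eulerianPoly, eulerianPoly, insertOp_sum, ← (insertMin_bijective n).sum_comp,
    Fintype.sum_prod_type_right]
  refine Finset.sum_congr rfl fun τ _ => ?_
  rw [Fin.sum_univ_succ, permDescents_insertMin_zero]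
  exact sum_X_pow_insert _ _ rfl fun q => permDescents_insertMin_succ q τ

theorem permExcedances_decomposeFin_zero {n : ℕ} (τ : Equiv.Perm (Fin n)) :
    permExcedances (Equiv.Perm.decomposeFin.symm (0, τ)) = permExcedances τ := by
  rw [permExcedances, permExcedances, Finset.card_filter, Finset.card_filter, Fin.sum_univ_succ]
  simp

/-- Inserting a new smallest element before `τ x` in its cycle makes it an excedance, and destroys
the excedance at `x` if there was one. -/
theorem permExcedances_decomposeFin_succ {n : ℕ} (x : Fin n) (τ : Equiv.Perm (Fin n)) :
    permExcedances (Equiv.Perm.decomposeFin.symm ((τ x).succ, τ)) +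
      (if x ∈ Finset.univ.filter (fun i : Fin n => i < τ i) then 1 else 0) =
      permExcedances τ + 1 := by
  rw [permExcedances, permExcedances, Finset.card_filter, Finset.card_filter, Fin.sum_univ_succ,
    Equiv.Perm.decomposeFin_symm_apply_zero, if_pos (Fin.succ_pos _),
    ← Finset.add_sum_erase _ _ (Finset.mem_univ x), ← Finset.add_sum_erase Finset.univ
      (fun i => if i < τ i then 1 else 0) (Finset.mem_univ x)]
  have h1 : ∀ i ∈ Finset.univ.erase x,
      (if i.succ < Equiv.Perm.decomposeFin.symm ((τ x).succ, τ) i.succ then 1 else 0) =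
        if i < τ i then 1 else 0 := by
    intro i hi
    rw [Equiv.Perm.decomposeFin_symm_apply_succ, Equiv.swap_apply_of_ne_of_ne (Fin.succ_ne_zero _)]
    · simp
    · intro h
      exact Finset.ne_of_mem_erase hi (τ.injective (Fin.succ_injective _ h))
  rw [Finset.sum_congr rfl h1, Equiv.Perm.decomposeFin_symm_apply_succ, Equiv.swap_apply_right]
  simp
  ring

theorem sum_X_pow_permExcedances_succ (n : ℕ) :
    ∑ σ : Equiv.Perm (Fin (n + 1)), (X : ℤ[X]) ^ permExcedances σ =
      insertOp n (∑ σ : Equiv.Perm (Fin n), X ^ permExcedances σ) := by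
  rw [insertOp_sum, ← Equiv.Perm.decomposeFin.symm.sum_comp, Fintype.sum_prod_type_right]
  refine Finset.sum_congr rfl fun τ _ => ?_
  rw [Fin.sum_univ_succ, permExcedances_decomposeFin_zero, ← Equiv.sum_comp τ]
  exact sum_X_pow_insert _ _ rfl fun x => permExcedances_decomposeFin_succ x τ

/-- Descents and excedances are equidistributed. -/
theorem eulerianPoly_eq_sum_permExcedances (n : ℕ) :
    eulerianPoly n = ∑ σ : Equiv.Perm (Fin n), X ^ permExcedances σ := by
  induction n with
  | zero => simp [eulerianPoly, permDescents, permExcedances]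
  | succ n ih => rw [eulerianPoly_succ, sum_X_pow_permExcedances_succ, ih]

/-- A permutation with a given set of moved points is a derangement of that set. -/
theorem sum_perm_support_eq {n : ℕ} (S : Finset (Fin n)) :
    ∑ σ : Equiv.Perm (Fin n) with σ.support = S, (X : ℤ[X]) ^ permExcedances σ =
      derangementPoly S.card := by
  classical
  let E := ((S.orderIsoOfFin rfl).toEquiv.derangementsCongr).trans
    (derangements.subtypeEquiv (· ∈ S))
  have hfix : ∀ σ : Equiv.Perm (Fin n), σ ∈ Finset.univ.filter (fun σ => σ.support = S) ↔
      ∀ a, ¬ a ∈ S ↔ a ∈ Function.fixedPoints σ := by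
    intro σ
    simp only [Finset.mem_filter, Finset.mem_univ, true_and, Finset.ext_iff,
      Equiv.Perm.mem_support, Function.mem_fixedPoints, Function.IsFixedPt]
    exact forall_congr' fun a => by tauto
  rw [derangementPoly, Finset.sum_subtype _ hfix, ← E.sum_comp]
  refine Finset.sum_congr rfl fun δ _ => congrArg _ ?_
  have happ : ∀ i : Fin S.card, (E δ : Equiv.Perm (Fin n)) (S.orderEmbOfFin rfl i) =
      S.orderEmbOfFin rfl ((δ : Equiv.Perm (Fin S.card)) i) := by
    intro i
    have h : (E δ : Equiv.Perm (Fin n)) = Equiv.Perm.ofSubtype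
        ((S.orderIsoOfFin rfl).toEquiv.permCongr (δ : Equiv.Perm (Fin S.card))) := rfl
    rw [h, ← Finset.coe_orderIsoOfFin_apply, Equiv.Perm.ofSubtype_apply_coe,
      ← Finset.coe_orderIsoOfFin_apply, Equiv.permCongr_apply]
    simp
  have hmap : (Finset.univ.filter fun a => a < (E δ : Equiv.Perm (Fin n)) a) =
      (Finset.univ.filter fun i => i < (δ : Equiv.Perm (Fin S.card)) i).map
        (S.orderEmbOfFin rfl).toEmbedding := by
    ext a
    simp only [Finset.mem_filter, Finset.mem_univ, true_and, Finset.mem_map,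
      RelEmbedding.coe_toEmbedding]
    constructor
    · intro h
      have ha : a ∈ S := by
        by_contra ha
        have : (E δ : Equiv.Perm (Fin n)) a = a := ((E δ).2 a).1 ha
        exact absurd h (by rw [this]; exact lt_irrefl a)
      obtain ⟨i, rfl⟩ : a ∈ Set.range (S.orderEmbOfFin rfl) := by simpa using ha
      refine ⟨i, ?_, rfl⟩
      rwa [happ, OrderEmbedding.lt_iff_lt] at h
    · rintro ⟨i, hi, rfl⟩
      rwa [happ, OrderEmbedding.lt_iff_lt]
  rw [permExcedances, permExcedances, hmap, Finset.card_map]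

/-- Grouping permutations by their set of moved points counts them by excedances and by fixed
points. -/
theorem sum_X_pow_permExcedances_mul_pow (n : ℕ) (Y : ℤ[X]) :
    ∑ σ : Equiv.Perm (Fin n), X ^ permExcedances σ * Y ^ (n - σ.support.card) =
      ∑ j ∈ Finset.range (n + 1), (n.choose j : ℤ[X]) * (derangementPoly j * Y ^ (n - j)) := by
  classical
  rw [← Finset.sum_fiberwise_of_maps_to (t := Finset.univ.powerset)
    (g := fun σ : Equiv.Perm (Fin n) => σ.support) (by simp)]
  have h : ∀ S ∈ (Finset.univ : Finset (Fin n)).powerset,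
      ∑ σ : Equiv.Perm (Fin n) with σ.support = S,
        (X : ℤ[X]) ^ permExcedances σ * Y ^ (n - σ.support.card) =
      derangementPoly S.card * Y ^ (n - S.card) := by
    intro S _
    rw [← sum_perm_support_eq, Finset.sum_mul]
    exact Finset.sum_congr rfl fun σ hσ => by rw [(Finset.mem_filter.1 hσ).2]
  rw [Finset.sum_congr rfl h,
    Finset.sum_powerset_apply_card (fun j => derangementPoly j * Y ^ (n - j)), Finset.card_univ,
    Fintype.card_fin]
  simp only [nsmul_eq_mul]

theorem eulerianPoly_eq_sum_derangementPoly (n : ℕ) :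
    eulerianPoly n = ∑ j ∈ Finset.range (n + 1), (n.choose j : ℤ[X]) * derangementPoly j := by
  have := sum_X_pow_permExcedances_mul_pow n 1
  simpa [eulerianPoly_eq_sum_permExcedances] using this

/-- Composing with the cyclic shift turns excedances into weak excedances, and adds one: position
`0` of the result always is a weak excedance, while the last position never is an excedance. -/
theorem card_weakExcedances_eq {n : ℕ} (τ : Equiv.Perm (Fin (n + 1))) :
    permExcedances τ + (n + 1 - τ.support.card) = permExcedances (τ * finRotate (n + 1)) + 1 := by
  have h1 : n + 1 - τ.support.card = (Finset.univ.filter fun i => τ i = i).card := by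
    have : (Finset.univ.filter fun i => τ i = i) = τ.supportᶜ := by ext; simp
    rw [this, Finset.card_compl, Fintype.card_fin]
  have h2 : permExcedances τ + (Finset.univ.filter fun i => τ i = i).card =
      (Finset.univ.filter fun i => i ≤ τ i).card := by
    rw [permExcedances, ← Finset.card_union_of_disjoint]
    · congr 1
      ext i
      simp [le_iff_lt_or_eq, eq_comm]
    · rw [Finset.disjoint_filter]
      intro i _ hi h
      rw [h] at hi
      exact lt_irrefl _ hi
  rw [h1, h2, permExcedances, Finset.card_filter, Finset.card_filter, Fin.sum_univ_succ,
    Fin.sum_univ_castSucc, if_pos (Fin.zero_le _), if_neg (not_lt.2 (Fin.le_last _)), add_zero,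
    add_comm]
  congr 1
  refine Finset.sum_congr rfl fun i _ => if_congr ?_ rfl rfl
  rw [Equiv.Perm.mul_apply, finRotate_apply, Fin.coeSucc_eq_succ, Fin.le_def, Fin.lt_def, Fin.val_succ,
    Fin.val_castSucc, Nat.succ_le_iff]

/-- Both sides count permutations of `Fin (n + 1)` by weak excedances. -/
theorem sum_derangementPoly_mul_X_pow {n : ℕ} (hn : 0 < n) :
    ∑ j ∈ Finset.range (n + 1), (n.choose j : ℤ[X]) * (derangementPoly j * X ^ (n - j)) =
      X * eulerianPoly n := by
  obtain ⟨n, rfl⟩ : ∃ m, n = m + 1 := ⟨n - 1, by omega⟩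
  rw [← sum_X_pow_permExcedances_mul_pow, eulerianPoly_eq_sum_permExcedances, Finset.mul_sum,
    ← Equiv.sum_comp (Equiv.mulRight (finRotate (n + 1)))
      (fun σ => (X : ℤ[X]) * X ^ permExcedances σ)]
  refine Finset.sum_congr rfl fun τ _ => ?_
  rw [← pow_add, card_weakExcedances_eq, Equiv.coe_mulRight, pow_succ']

end Eulerian

/-! ### Recursions for the Eulerian and derangement polynomials -/

section Recursions

/-- Taking binomial convolutions with the powers of `Y` and with the powers of `Z` commutes: both
orders are the image of `(T + Y + Z)^m` under the linear map that sends `T^r` to `d r`. -/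
theorem sum_choose_mul_sum_choose (d : ℕ → ℤ[X]) (Y Z : ℤ[X]) (m : ℕ) :
    ∑ l ∈ Finset.range (m + 1), (m.choose l : ℤ[X]) * (Y ^ (m - l) *
      ∑ r ∈ Finset.range (l + 1), (l.choose r : ℤ[X]) * (d r * Z ^ (l - r))) =
    ∑ l ∈ Finset.range (m + 1), (m.choose l : ℤ[X]) * (Z ^ (m - l) *
      ∑ r ∈ Finset.range (l + 1), (l.choose r : ℤ[X]) * (d r * Y ^ (l - r))) := by
  let L : ℤ[X][X] →ₗ[ℤ[X]] ℤ[X] :=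
    Polynomial.lsum fun r => LinearMap.toSpanSingleton ℤ[X] ℤ[X] (d r)
  have hL : ∀ r (a : ℤ[X]), L (X ^ r * C a) = a * d r := by
    intro r a
    rw [mul_comm, C_mul_X_pow_eq_monomial, Polynomial.lsum_apply, sum_monomial_index _ _ (by simp)]
    simp
  have key : ∀ Y Z : ℤ[X], ∑ l ∈ Finset.range (m + 1), (m.choose l : ℤ[X]) * (Y ^ (m - l) *
      ∑ r ∈ Finset.range (l + 1), (l.choose r : ℤ[X]) * (d r * Z ^ (l - r))) =
      L ((X + C Z + C Y) ^ m) := by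
    intro Y Z
    rw [add_pow, map_sum]
    refine Finset.sum_congr rfl fun l _ => ?_
    have h1 : ((X : ℤ[X][X]) + C Z) ^ l * C Y ^ (m - l) * (m.choose l : ℤ[X][X]) =
        (Y ^ (m - l) * (m.choose l : ℤ[X])) • (X + C Z) ^ l := by
      rw [smul_eq_C_mul, map_mul, map_pow, map_natCast]
      ring
    rw [h1, map_smul, add_pow, map_sum, smul_eq_mul, mul_assoc, mul_left_comm]
    congr 2
    refine Finset.sum_congr rfl fun r _ => ?_
    have h2 : (X : ℤ[X][X]) ^ r * C Z ^ (l - r) * (l.choose r : ℤ[X][X]) =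
        X ^ r * C (Z ^ (l - r) * (l.choose r : ℤ[X])) := by
      rw [map_mul, map_pow, map_natCast]
      ring
    rw [h2, hL]
    ring
  rw [key, key, add_right_comm]

theorem eulerianPoly_zero : eulerianPoly 0 = 1 := by
  simp [eulerianPoly, permDescents]

theorem derangementPoly_zero : derangementPoly 0 = 1 := by
  simpa [eulerianPoly_zero] using (eulerianPoly_eq_sum_derangementPoly 0).symm

/-- The binomial transform, from derangements to all permutations, of the identity
`∑_r (l choose r) d_r x^{l-r} = x A_l` for `l > 0`. -/
theorem sum_choose_eulerianPoly_mul_X_pow (m : ℕ) :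
    ∑ l ∈ Finset.range (m + 1), (m.choose l : ℤ[X]) * (X ^ (m - l) * eulerianPoly l) =
      1 - X + X * ∑ l ∈ Finset.range (m + 1), (m.choose l : ℤ[X]) * eulerianPoly l := by
  have h := sum_choose_mul_sum_choose derangementPoly X 1 m
  simp only [one_pow, mul_one, one_mul, ← eulerianPoly_eq_sum_derangementPoly] at h
  rw [h, Finset.sum_range_succ' _ m,
    Finset.sum_range_succ' (fun l => (m.choose l : ℤ[X]) * eulerianPoly l) m]
  have h2 : ∀ l ∈ Finset.range m, (m.choose (l + 1) : ℤ[X]) *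
      ∑ r ∈ Finset.range (l + 1 + 1), ((l + 1).choose r : ℤ[X]) *
        (derangementPoly r * X ^ (l + 1 - r)) =
      X * ((m.choose (l + 1) : ℤ[X]) * eulerianPoly (l + 1)) := by
    intro l _
    rw [sum_derangementPoly_mul_X_pow (Nat.succ_pos l)]
    ring
  rw [Finset.sum_congr rfl h2, ← Finset.mul_sum]
  simp [derangementPoly_zero, eulerianPoly_zero]
  ring

/-- Multiplying by `X - 1` turns the geometric sums of the Hilbert series into powers of `X`. -/
theorem X_sub_one_mul_sum_geom (e : ℕ → ℤ[X]) (j : ℕ) :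
    (X - 1) * (X * ∑ l ∈ Finset.range j, ((j + 1).choose l : ℤ[X]) * e l *
      ∑ i ∈ Finset.range (j - l), X ^ i) =
    ∑ l ∈ Finset.range (j + 1), ((j + 1).choose l : ℤ[X]) * e l * (X ^ (j + 1 - l) - X) := by
  rw [Finset.sum_range_succ, Nat.add_sub_cancel_left, pow_one, sub_self, mul_zero, add_zero,
    Finset.mul_sum, Finset.mul_sum]
  refine Finset.sum_congr rfl fun l hl => ?_
  have hl' := Finset.mem_range.1 hl
  rw [show j + 1 - l = (j - l) + 1 by omega, pow_succ]
  linear_combination (((j + 1).choose l : ℤ[X]) * e l * X) *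
    mul_geom_sum (X : ℤ[X]) (j - l)

theorem sum_choose_mul_sub (e : ℕ → ℤ[X]) (m : ℕ) :
    ∑ l ∈ Finset.range m, (m.choose l : ℤ[X]) * e l * (X ^ (m - l) - X) =
      ∑ l ∈ Finset.range (m + 1), (m.choose l : ℤ[X]) * (X ^ (m - l) * e l) -
        X * ∑ l ∈ Finset.range (m + 1), (m.choose l : ℤ[X]) * e l + (X - 1) * e m := by
  rw [Finset.sum_range_succ, Finset.sum_range_succ _ m, mul_add, Finset.mul_sum]
  have : ∀ l ∈ Finset.range m, (m.choose l : ℤ[X]) * e l * (X ^ (m - l) - X) =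
      (m.choose l : ℤ[X]) * (X ^ (m - l) * e l) - X * ((m.choose l : ℤ[X]) * e l) :=
    fun l _ => by ring
  rw [Finset.sum_congr rfl this, Finset.sum_sub_distrib]
  simp
  ring

theorem polynomial_X_sub_one_ne_zero : (X - 1 : ℤ[X]) ≠ 0 := by
  simpa using X_sub_C_ne_zero (1 : ℤ)

/-- The recursion that matches the principal ideals of corank one flats: `d_j` is `x` times the
Hilbert series of the Chow ring of `U_{j-1,j}`. -/
theorem derangementPoly_succ (j : ℕ) :
    derangementPoly (j + 1) = X * ∑ l ∈ Finset.range j, ((j + 1).choose l : ℤ[X]) *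
      derangementPoly l * ∑ i ∈ Finset.range (j - l), X ^ i := by
  apply mul_left_cancel₀ polynomial_X_sub_one_ne_zero
  rw [X_sub_one_mul_sum_geom, sum_choose_mul_sub, ← eulerianPoly_eq_sum_derangementPoly,
    ← sum_derangementPoly_mul_X_pow (Nat.succ_pos j)]
  simp_rw [mul_comm (derangementPoly _)]
  ring

/-- The Eulerian polynomial `A_j` is the Hilbert series of the augmented Chow ring of
`U_{j-1,j}`. -/
theorem eulerianPoly_succ_eq_sum (j : ℕ) :
    eulerianPoly (j + 1) = 1 + X * ∑ l ∈ Finset.range j, ((j + 1).choose l : ℤ[X]) *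
      eulerianPoly l * ∑ i ∈ Finset.range (j - l), X ^ i := by
  apply mul_left_cancel₀ polynomial_X_sub_one_ne_zero
  rw [mul_add, X_sub_one_mul_sum_geom, sum_choose_mul_sub, sum_choose_eulerianPoly_mul_X_pow]
  ring

/-- The coefficients `e_j` in the Hilbert series of the augmented Chow ring: `1` for `j = 0`, and
`x A_j(x)` for `j > 0`. -/
noncomputable def shiftedEulerianPoly (j : ℕ) : ℤ[X] :=
  if j = 0 then 1 else X * eulerianPoly j

theorem chowPoly_shiftedEulerianPoly (n k : ℕ) :
    chowPoly 1 shiftedEulerianPoly n k =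
      1 + X * ∑ j ∈ Finset.range k, (n.choose j : ℤ[X]) * eulerianPoly j *
        ∑ i ∈ Finset.range (k - j), X ^ i := by
  cases k with
  | zero => simp [chowPoly]
  | succ k =>
    have h : ∀ j ∈ Finset.range k, (n.choose (j + 1) : ℤ[X]) * shiftedEulerianPoly (j + 1) *
        ∑ i ∈ Finset.range (k + 1 - (j + 1)), X ^ i =
        X * ((n.choose (j + 1) : ℤ[X]) * eulerianPoly (j + 1) *
          ∑ i ∈ Finset.range (k + 1 - (j + 1)), X ^ i) := by
      intro j _
      rw [shiftedEulerianPoly, if_neg (Nat.succ_ne_zero j)]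
      ring
    rw [chowPoly, Finset.sum_range_succ', Finset.sum_congr rfl h, ← Finset.mul_sum,
      Finset.sum_range_succ' _ k, eulerianPoly_zero, shiftedEulerianPoly, if_pos rfl]
    have := mul_geom_sum (X : ℤ[X]) (k + 1)
    simp only [Nat.choose_zero_right, Nat.cast_one, Nat.sub_zero]
    linear_combination -this

theorem shiftedEulerianPoly_succ (j : ℕ) :
    shiftedEulerianPoly (j + 1) = X * chowPoly 1 shiftedEulerianPoly (j + 1) j := by
  rw [chowPoly_shiftedEulerianPoly, ← eulerianPoly_succ_eq_sum, shiftedEulerianPoly,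
    if_neg (Nat.succ_ne_zero j)]

theorem eval_one_eulerianPoly (n : ℕ) : (eulerianPoly n).eval 1 = n.factorial := by
  simp [eulerianPoly, eval_finsetSum, Fintype.card_perm]

/-- In full rank the recursion for `e` collapses the geometric sums, which makes the value at `1`
easy to compute. -/
theorem chowPoly_self_of_succ {ε : ℤ[X]} {e : ℕ → ℤ[X]} {m : ℕ}
    (he : e (m + 1) = X * chowPoly ε e (m + 1) m) :
    chowPoly ε e (m + 1) (m + 1) = choosePoly e (m + 1) (m + 2) := by
  rw [chowPoly_succ, ← he, choosePoly_succ _ (m + 1), Nat.choose_self, Nat.cast_one, one_mul]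

theorem hilbertFn_relIdeal_chow {n k : ℕ} (hn : 0 < n) (hk : k ≤ n) (j : ℕ) :
    (hilbertFn (relIdeal True n k) j : ℤ) = (chowPoly 0 derangementPoly n k).coeff j := by
  have hz : rankZeroPoly True = 0 := by simp [rankZeroPoly]
  have he : ∀ j, derangementPoly (j + 1) = X * chowPoly 0 derangementPoly (j + 1) j := by
    intro j
    rw [derangementPoly_succ, chowPoly, zero_mul, add_zero]
  have := hilbertFn_relIdeal_eq_coeff (c := True) derangementPoly_zero (by rwa [hz])
    (exists_factorial_le_sum_hilbertFn hn) (by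
      rw [hz]
      obtain ⟨m, rfl⟩ : ∃ m, n = m + 1 := ⟨n - 1, by omega⟩
      rw [chowPoly_self_of_succ (he m), choosePoly, ← eulerianPoly_eq_sum_derangementPoly,
        eval_one_eulerianPoly]) (n - k) k (by omega) j
  rwa [hz] at this

theorem hilbertFn_relIdeal_augmented {n k : ℕ} (hk : k ≤ n) (j : ℕ) :
    (hilbertFn (relIdeal False n k) j : ℤ) =
      (chowPoly 1 shiftedEulerianPoly n k).coeff j := by
  have hz : rankZeroPoly False = 1 := by simp [rankZeroPoly]
  have heval : ∀ j, (shiftedEulerianPoly j).eval 1 = j.factorial := by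
    intro j
    rw [shiftedEulerianPoly]
    split_ifs with h
    · simp [h]
    · simp [eval_one_eulerianPoly]
  have := hilbertFn_relIdeal_eq_coeff (c := False) (e := shiftedEulerianPoly)
    (by simp [shiftedEulerianPoly])
    (by rw [hz]; exact shiftedEulerianPoly_succ)
    (exists_sum_choose_mul_factorial_le_sum_hilbertFn not_false n) (by
      rw [hz]
      cases n with
      | zero => simp [chowPoly]
      | succ m =>
        rw [chowPoly_self_of_succ (shiftedEulerianPoly_succ m), choosePoly, eval_finsetSum]
        push_cast
        refine Finset.sum_congr rfl fun j _ => ?_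
        rw [eval_mul, heval, eval_natCast]) (n - k) k (by omega) j
  rwa [hz] at this

end Recursions

/-! ### Flats of uniform matroids -/

section UniformFlats

open Matroid

variable {n k : ℕ} {hkn : k ≤ n}

theorem uniform_isBase_iff {B : Set (Fin n)} : (uniform k n hkn).IsBase B ↔ B.ncard = k := by
  simp [uniform]

theorem uniform_ground : (uniform k n hkn).E = Set.univ := rfl

theorem uniform_indep_of_ncard_le {I : Set (Fin n)} (hI : I.ncard ≤ k) :
    (uniform k n hkn).Indep I := by
  obtain ⟨B, hIB, -, hB⟩ := Set.exists_subsuperset_card_eq (Set.subset_univ I) hI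
    (by simpa [Set.ncard_univ] using hkn)
  exact (uniform_isBase_iff.2 hB).indep.subset hIB

theorem uniform_isFlat_and_ne_ground_iff {F : Set (Fin n)} :
    ((uniform k n hkn).IsFlat F ∧ F ≠ (uniform k n hkn).E) ↔ F.ncard < k := by
  constructor
  · rintro ⟨hF, hne⟩
    by_contra! h
    obtain ⟨B, hBF, hB⟩ := Set.exists_subset_card_eq h
    refine hne ?_
    rw [← hF.closure]
    exact ((uniform_isBase_iff.2 hB).spanning_of_superset hBF hF.subset_ground).closure_eq
  · intro h
    refine ⟨isFlat_iff_closure_eq.2 (Set.Subset.antisymm ?_ ?_), ?_⟩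
    · intro a ha
      by_contra haF
      have hins : (uniform k n hkn).Indep (insert a F) :=
        uniform_indep_of_ncard_le ((Set.ncard_insert_le a F).trans h)
      rw [(uniform_indep_of_ncard_le h.le).mem_closure_iff_of_notMem haF] at ha
      exact ha.not_indep hins
    · exact subset_closure _ F (Set.subset_univ F)
    · rintro rfl
      rw [uniform_ground, Set.ncard_univ, Nat.card_eq_fintype_card, Fintype.card_fin] at h
      omega

/-- The finset underlying a subset of `Fin n`. -/
noncomputable def finsetOf (F : Set (Fin n)) : Finset (Fin n) := F.toFinite.toFinset

@[simp] theorem mem_finsetOf {F : Set (Fin n)} {i : Fin n} : i ∈ finsetOf F ↔ i ∈ F := by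
  simp [finsetOf]

@[simp] theorem coe_finsetOf (F : Set (Fin n)) : (finsetOf F : Set (Fin n)) = F := by
  simp [finsetOf]

@[simp] theorem finsetOf_coe (G : Finset (Fin n)) : finsetOf (G : Set (Fin n)) = G := by
  simp [finsetOf]

theorem finsetOf_subset_iff {F G : Set (Fin n)} : finsetOf F ⊆ finsetOf G ↔ F ⊆ G := by
  simp [finsetOf]

theorem card_finsetOf (F : Set (Fin n)) : (finsetOf F).card = F.ncard :=
  (Set.ncard_eq_toFinset_card F).symm

theorem card_finsetOf_lt (F : (uniform k n hkn).NontopFlat) : (finsetOf F.1).card < k := by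
  rw [card_finsetOf]
  exact uniform_isFlat_and_ne_ground_iff.1 F.2

/-- A set with fewer than `k` elements, as a flat of `U_{k,n}`. -/
def toNontopFlat (hkn : k ≤ n) (G : Finset (Fin n)) (h : G.card < k) :
    (uniform k n hkn).NontopFlat :=
  ⟨G, uniform_isFlat_and_ne_ground_iff.2 (by rwa [Set.ncard_coe_finset])⟩

theorem toNontopFlat_finsetOf (F : (uniform k n hkn).NontopFlat) :
    toNontopFlat hkn (finsetOf F.1) (card_finsetOf_lt F) = F :=
  Subtype.ext (coe_finsetOf F.1)

theorem card_finsetOf_properFlat (F : (uniform k n hkn).ProperFlat) :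
    0 < (finsetOf F.1).card ∧ (finsetOf F.1).card < k := by
  refine ⟨?_, ?_⟩
  · rw [card_finsetOf]
    exact (Set.ncard_pos (Set.toFinite _)).2 (Set.nonempty_iff_ne_empty.2 F.2.2.1)
  · rw [card_finsetOf]
    exact uniform_isFlat_and_ne_ground_iff.1 ⟨F.2.1, F.2.2.2⟩

/-- A nonempty set with fewer than `k` elements, as a proper flat of `U_{k,n}`. -/
def toProperFlat (hkn : k ≤ n) (G : Finset (Fin n)) (h : 0 < G.card ∧ G.card < k) :
    (uniform k n hkn).ProperFlat :=
  ⟨G, (toNontopFlat hkn G h.2).2.1,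
    by simpa using (Finset.card_pos.1 h.1).ne_empty, (toNontopFlat hkn G h.2).2.2⟩

theorem toProperFlat_finsetOf (F : (uniform k n hkn).ProperFlat) :
    toProperFlat hkn (finsetOf F.1) (card_finsetOf_properFlat F) = F :=
  Subtype.ext (coe_finsetOf F.1)

end UniformFlats

/-! ### Comparison with the augmented Chow ring -/

section AugmentedComparison

open Matroid

variable {n k : ℕ}

/-- The map from the presentation of the augmented Chow ring of `U_{k,n}` that sends `y_i` to
`∑_{G ∌ i} x_G`. -/
noncomputable def ofAugmented (hkn : k ≤ n) :
    MvPolynomial ((uniform k n hkn).NontopFlat ⊕ (uniform k n hkn).E) ℚ →ₐ[ℚ]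
      MvPolynomial (Finset (Fin n)) ℚ :=
  MvPolynomial.aeval
    (Sum.elim (fun F => MvPolynomial.X (finsetOf F.1)) fun i => avoidForm i.1)

/-- The map to the presentation of the augmented Chow ring of `U_{k,n}` that kills the variables of
the sets that are not flats, or are the ground set. -/
noncomputable def toAugmented (hkn : k ≤ n) :
    MvPolynomial (Finset (Fin n)) ℚ →ₐ[ℚ]
      MvPolynomial ((uniform k n hkn).NontopFlat ⊕ (uniform k n hkn).E) ℚ :=
  MvPolynomial.aeval fun G =>
    if h : G.card < k then (uniform k n hkn).augX (toNontopFlat hkn G h) else 0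

variable {hkn : k ≤ n}

theorem ofAugmented_augX (F : (uniform k n hkn).NontopFlat) :
    ofAugmented hkn ((uniform k n hkn).augX F) = MvPolynomial.X (finsetOf F.1) := by
  simp [ofAugmented, augX]

theorem ofAugmented_augY (i : (uniform k n hkn).E) :
    ofAugmented hkn ((uniform k n hkn).augY i) = avoidForm i.1 := by
  simp [ofAugmented, augY]

theorem toAugmented_X_of_lt {G : Finset (Fin n)} (h : G.card < k) :
    toAugmented hkn (MvPolynomial.X G) = (uniform k n hkn).augX (toNontopFlat hkn G h) := by
  simp [toAugmented, h]

theorem toAugmented_X_of_le {G : Finset (Fin n)} (h : k ≤ G.card) :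
    toAugmented hkn (MvPolynomial.X G) = 0 := by
  simp [toAugmented, not_lt.2 h]

theorem toAugmented_X_finsetOf (F : (uniform k n hkn).NontopFlat) :
    toAugmented hkn (MvPolynomial.X (finsetOf F.1)) = (uniform k n hkn).augX F := by
  rw [toAugmented_X_of_lt (card_finsetOf_lt F), toNontopFlat_finsetOf]

open Classical in
theorem sum_nontopFlat {A : Type*} [AddCommMonoid A] (f : Finset (Fin n) → A) (i : Fin n) :
    ∑ F : (uniform k n hkn).NontopFlat with i ∉ F.1, f (finsetOf F.1) =
      ∑ G : Finset (Fin n) with i ∉ G ∧ G.card < k, f G := by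
  refine Finset.sum_bij' (fun F _ => finsetOf F.1)
    (fun G hG => toNontopFlat hkn G (Finset.mem_filter.1 hG).2.2) ?_ ?_ ?_ ?_ ?_
  · intro F hF
    simpa [card_finsetOf_lt F] using hF
  · intro G hG
    simpa [toNontopFlat] using (Finset.mem_filter.1 hG).2.1
  · exact fun F _ => toNontopFlat_finsetOf F
  · exact fun G _ => finsetOf_coe G
  · exact fun _ _ => rfl

theorem avoidForm_sub_sum_mem {c : Prop} (i : Fin n) :
    avoidForm i - ∑ G : Finset (Fin n) with i ∉ G ∧ G.card < k, MvPolynomial.X G ∈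
      relIdeal c n k := by
  rw [avoidForm, ← Finset.filter_filter,
    ← Finset.sum_filter_add_sum_filter_not (Finset.univ.filter fun G => i ∉ G)
      (fun G => G.card < k), add_sub_cancel_left]
  exact sum_mem fun G hG => (IsRel.large G (not_lt.1 (Finset.mem_filter.1 hG).2)).mem

theorem augY_sub_toAugmented_avoidForm_mem (i : (uniform k n hkn).E) :
    (uniform k n hkn).augY i - toAugmented hkn (avoidForm i.1) ∈
      (uniform k n hkn).augmentedChowIdeal := by
  classical
  refine Ideal.mem_sup_left (Ideal.subset_span ⟨i, congrArg _ ?_⟩)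
  have h1 : toAugmented hkn (avoidForm i.1) =
      ∑ G : Finset (Fin n) with i.1 ∉ G ∧ G.card < k, toAugmented hkn (MvPolynomial.X G) := by
    rw [avoidForm, map_sum, ← Finset.filter_filter]
    refine (Finset.sum_subset (Finset.filter_subset _ _) fun G hG hG' => ?_).symm
    refine toAugmented_X_of_le (not_lt.1 fun h => hG' (Finset.mem_filter.2 ⟨hG, h⟩))
  rw [h1, ← sum_nontopFlat (hkn := hkn)]
  simp_rw [toAugmented_X_finsetOf]

theorem augmentedChowIdeal_le_comap :
    (uniform k n hkn).augmentedChowIdeal ≤ (relIdeal False n k).comap (ofAugmented hkn) := by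
  classical
  refine sup_le (Ideal.span_le.2 ?_) (sup_le (Ideal.span_le.2 ?_) (Ideal.span_le.2 ?_))
  · rintro _ ⟨i, rfl⟩
    rw [SetLike.mem_coe, Ideal.mem_comap, map_sub, map_sum, ofAugmented_augY]
    simp_rw [ofAugmented_augX]
    have := avoidForm_sub_sum_mem (c := False) (k := k) i.1
    rw [← sum_nontopFlat (hkn := hkn)] at this
    convert this using 3
  · rintro _ ⟨F, G, h, h', rfl⟩
    rw [SetLike.mem_coe, Ideal.mem_comap, map_mul, ofAugmented_augX, ofAugmented_augX]
    exact (IsRel.incomp _ _ (by rwa [finsetOf_subset_iff]) (by rwa [finsetOf_subset_iff])).mem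
  · rintro _ ⟨i, F, h, rfl⟩
    rw [SetLike.mem_coe, Ideal.mem_comap, map_mul, ofAugmented_augX, ofAugmented_augY, mul_comm]
    exact (IsRel.aug _ _ (by rwa [mem_finsetOf])).mem

theorem relIdeal_le_comap_toAugmented :
    relIdeal False n k ≤ (uniform k n hkn).augmentedChowIdeal.comap (toAugmented hkn) := by
  refine Ideal.span_le.2 fun p hp => ?_
  rw [SetLike.mem_coe, Ideal.mem_comap]
  cases hp with
  | large G h => rw [toAugmented_X_of_le h]; exact zero_mem _
  | incomp F G h h' =>
    rw [map_mul]
    rcases lt_or_ge F.card k with hF | hF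
    · rcases lt_or_ge G.card k with hG | hG
      · rw [toAugmented_X_of_lt hF, toAugmented_X_of_lt hG]
        refine Ideal.mem_sup_right (Ideal.mem_sup_left (Ideal.subset_span ⟨_, _, ?_, ?_, rfl⟩))
        · exact fun hs => h (Finset.coe_subset.1 hs)
        · exact fun hs => h' (Finset.coe_subset.1 hs)
      · rw [toAugmented_X_of_le hG, mul_zero]; exact zero_mem _
    · rw [toAugmented_X_of_le hF, zero_mul]; exact zero_mem _
  | aug F i h =>
    rw [map_mul]
    rcases lt_or_ge F.card k with hF | hF
    · rw [toAugmented_X_of_lt hF]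
      have h1 := augY_sub_toAugmented_avoidForm_mem (hkn := hkn) ⟨i, Set.mem_univ i⟩
      have h2 : (uniform k n hkn).augY ⟨i, Set.mem_univ i⟩ *
          (uniform k n hkn).augX (toNontopFlat hkn F hF) ∈
            (uniform k n hkn).augmentedChowIdeal :=
        Ideal.mem_sup_right (Ideal.mem_sup_right (Ideal.subset_span
          ⟨⟨i, Set.mem_univ i⟩, _, fun hi => h (Finset.mem_coe.1 hi), rfl⟩))
      convert sub_mem h2 (Ideal.mul_mem_left _
        ((uniform k n hkn).augX (toNontopFlat hkn F hF)) h1) using 1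
      ring
    · rw [toAugmented_X_of_le hF, zero_mul]; exact zero_mem _
  | chow i h => exact h.elim
  | unit h hk => exact h.elim

theorem hilbertFn_augmentedChowIdeal (j : ℕ) :
    hilbertFn (uniform k n hkn).augmentedChowIdeal j = hilbertFn (relIdeal False n k) j := by
  refine le_antisymm
    (hilbertFn_le_of_surjective _ _ (toAugmented hkn)
      (fun p hp => relIdeal_le_comap_toAugmented hp) ?_ j)
    (hilbertFn_le_of_surjective _ _ (ofAugmented hkn)
      (fun p hp => augmentedChowIdeal_le_comap hp) ?_ j)
  · rintro (F | i)
    · refine ⟨MvPolynomial.X (finsetOf F.1), MvPolynomial.isHomogeneous_X _ _, ?_⟩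
      rw [toAugmented_X_finsetOf, augX, sub_self]
      exact zero_mem _
    · exact ⟨avoidForm i.1, avoidForm_mem_homogeneous _,
        augY_sub_toAugmented_avoidForm_mem i⟩
  · intro G
    rcases lt_or_ge G.card k with hG | hG
    · refine ⟨(uniform k n hkn).augX (toNontopFlat hkn G hG), MvPolynomial.isHomogeneous_X _ _, ?_⟩
      rw [ofAugmented_augX]
      simp [toNontopFlat]
    · refine ⟨0, zero_mem _, ?_⟩
      rw [map_zero, sub_zero]
      exact (IsRel.large G hG).mem

end AugmentedComparison

/-! ### Comparison with the Chow ring -/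

section ChowComparison

open Matroid

variable {n k : ℕ}

open Classical in
/-- The form `∑_{F ∌ i} x_F`, over the proper flats `F` of `U_{k,n}`. -/
noncomputable def properAvoidForm (hkn : k ≤ n) (i : Fin n) :
    MvPolynomial (uniform k n hkn).ProperFlat ℚ :=
  ∑ F : (uniform k n hkn).ProperFlat with i ∉ F.1, MvPolynomial.X F

/-- The map from the presentation of the Chow ring of `U_{k,n}`. -/
noncomputable def ofChow (hkn : k ≤ n) :
    MvPolynomial (uniform k n hkn).ProperFlat ℚ →ₐ[ℚ] MvPolynomial (Finset (Fin n)) ℚ :=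
  MvPolynomial.aeval fun F => MvPolynomial.X (finsetOf F.1)

/-- The map to the presentation of the Chow ring of `U_{k,n}`; the variable of the empty set is sent
to minus the sum of the variables of the proper flats avoiding `i₀`. -/
noncomputable def toChow (hkn : k ≤ n) (i₀ : Fin n) :
    MvPolynomial (Finset (Fin n)) ℚ →ₐ[ℚ] MvPolynomial (uniform k n hkn).ProperFlat ℚ :=
  MvPolynomial.aeval fun G =>
    if h : 0 < G.card ∧ G.card < k then MvPolynomial.X (toProperFlat hkn G h)
    else if G = ∅ then -properAvoidForm hkn i₀ else 0

variable {hkn : k ≤ n} {i₀ : Fin n}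

theorem ofChow_X (F : (uniform k n hkn).ProperFlat) :
    ofChow hkn (MvPolynomial.X F) = MvPolynomial.X (finsetOf F.1) := by
  simp [ofChow]

theorem toChow_X {G : Finset (Fin n)} (h : 0 < G.card ∧ G.card < k) :
    toChow hkn i₀ (MvPolynomial.X G) = MvPolynomial.X (toProperFlat hkn G h) := by
  simp only [toChow, MvPolynomial.aeval_X, dif_pos h]

theorem toChow_X_empty :
    toChow hkn i₀ (MvPolynomial.X ∅) = -properAvoidForm hkn i₀ := by
  simp [toChow]

theorem toChow_X_of_le (hk : 0 < k) {G : Finset (Fin n)} (h : k ≤ G.card) :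
    toChow hkn i₀ (MvPolynomial.X G) = 0 := by
  have hG : G ≠ ∅ := by rintro rfl; rw [Finset.card_empty] at h; omega
  simp only [toChow, MvPolynomial.aeval_X]
  rw [dif_neg (by omega), if_neg hG]

theorem toChow_X_finsetOf (F : (uniform k n hkn).ProperFlat) :
    toChow hkn i₀ (MvPolynomial.X (finsetOf F.1)) = MvPolynomial.X F := by
  rw [toChow_X (card_finsetOf_properFlat F), toProperFlat_finsetOf]

theorem chowLinearForm_add_properAvoidForm (i : Fin n) :
    (uniform k n hkn).chowLinearForm i + properAvoidForm hkn i =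
      ∑ F : (uniform k n hkn).ProperFlat, MvPolynomial.X F := by
  classical
  rw [← Finset.sum_filter_add_sum_filter_not Finset.univ
    fun F : (uniform k n hkn).ProperFlat => i ∈ F.1]
  unfold chowLinearForm properAvoidForm
  congr!

theorem chowLinearForm_sub (i j : Fin n) :
    (uniform k n hkn).chowLinearForm i - (uniform k n hkn).chowLinearForm j =
      properAvoidForm hkn j - properAvoidForm hkn i := by
  have h1 := chowLinearForm_add_properAvoidForm (hkn := hkn) i
  have h2 := chowLinearForm_add_properAvoidForm (hkn := hkn) j
  linear_combination h1 - h2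

open Classical in
theorem sum_properFlat {A : Type*} [AddCommMonoid A] (f : Finset (Fin n) → A) (i : Fin n) :
    ∑ F : (uniform k n hkn).ProperFlat with i ∉ F.1, f (finsetOf F.1) =
      ∑ G ∈ (Finset.univ.filter fun G : Finset (Fin n) => i ∉ G ∧ G.card < k).erase ∅, f G := by
  have hmem : ∀ G, G ∈ (Finset.univ.filter fun G : Finset (Fin n) =>
      i ∉ G ∧ G.card < k).erase ∅ ↔ i ∉ G ∧ 0 < G.card ∧ G.card < k := by
    intro G
    simp only [Finset.mem_erase, Finset.mem_filter, Finset.mem_univ, true_and, Finset.card_pos,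
      Finset.nonempty_iff_ne_empty]
    tauto
  refine Finset.sum_bij' (fun F _ => finsetOf F.1)
    (fun G hG => toProperFlat hkn G ((hmem G).1 hG).2) ?_ ?_ ?_ ?_ ?_
  · intro F hF
    exact (hmem _).2 ⟨by simpa using hF, card_finsetOf_properFlat F⟩
  · intro G hG
    simpa [toProperFlat] using ((hmem G).1 hG).1
  · exact fun F _ => toProperFlat_finsetOf F
  · exact fun G _ => finsetOf_coe G
  · exact fun _ _ => rfl

open Classical in
theorem sum_properFlat_add_empty {A : Type*} [AddCommMonoid A] (hk : 0 < k)
    (f : Finset (Fin n) → A) (i : Fin n) :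
    ∑ F : (uniform k n hkn).ProperFlat with i ∉ F.1, f (finsetOf F.1) + f ∅ =
      ∑ G : Finset (Fin n) with i ∉ G ∧ G.card < k, f G := by
  rw [← Finset.sum_erase_add (Finset.univ.filter fun G : Finset (Fin n) => i ∉ G ∧ G.card < k) f
    (a := ∅) (by simpa using hk), ← sum_properFlat (hkn := hkn)]

theorem avoidForm_sub_ofChow_mem {c : Prop} (hk : 0 < k) (i : Fin n) :
    avoidForm i - (ofChow hkn (properAvoidForm hkn i) + MvPolynomial.X ∅) ∈ relIdeal c n k := by
  have h := avoidForm_sub_sum_mem (c := c) (k := k) i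
  rw [← sum_properFlat_add_empty (hkn := hkn) hk] at h
  rw [properAvoidForm, map_sum]
  simp_rw [ofChow_X]
  exact h

theorem toChow_avoidForm (hk : 0 < k) (i : Fin n) :
    toChow hkn i₀ (avoidForm i) = properAvoidForm hkn i - properAvoidForm hkn i₀ := by
  have h1 : toChow hkn i₀ (avoidForm i) =
      ∑ G : Finset (Fin n) with i ∉ G ∧ G.card < k, toChow hkn i₀ (MvPolynomial.X G) := by
    rw [avoidForm, map_sum, ← Finset.filter_filter]
    refine (Finset.sum_subset (Finset.filter_subset _ _) fun G hG hG' => ?_).symm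
    refine toChow_X_of_le hk (not_lt.1 fun h => hG' (Finset.mem_filter.2 ⟨hG, h⟩))
  rw [h1, ← sum_properFlat_add_empty (hkn := hkn) hk, toChow_X_empty, ← sub_eq_add_neg]
  simp_rw [toChow_X_finsetOf]
  rfl

theorem chowIdeal_le_comap (hk : 0 < k) :
    (uniform k n hkn).chowIdeal ≤ (relIdeal True n k).comap (ofChow hkn) := by
  refine sup_le (Ideal.span_le.2 ?_) (Ideal.span_le.2 ?_)
  · rintro _ ⟨F, G, h, h', rfl⟩
    rw [SetLike.mem_coe, Ideal.mem_comap, map_mul, ofChow_X, ofChow_X]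
    exact (IsRel.incomp _ _ (by rwa [finsetOf_subset_iff]) (by rwa [finsetOf_subset_iff])).mem
  · rintro _ ⟨i, -, j, -, rfl⟩
    rw [SetLike.mem_coe, Ideal.mem_comap, chowLinearForm_sub, map_sub]
    have h1 := sub_mem (IsRel.chow (c := True) (k := k) j trivial).mem
      (avoidForm_sub_ofChow_mem (hkn := hkn) hk j)
    have h2 := sub_mem (IsRel.chow (c := True) (k := k) i trivial).mem
      (avoidForm_sub_ofChow_mem (hkn := hkn) hk i)
    convert sub_mem h1 h2 using 1
    ring

theorem toChow_avoidForm_mem (hk : 0 < k) (i : Fin n) :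
    toChow hkn i₀ (avoidForm i) ∈ (uniform k n hkn).chowIdeal := by
  rw [toChow_avoidForm hk, ← chowLinearForm_sub]
  exact Ideal.mem_sup_right (Ideal.subset_span
    ⟨i₀, Set.mem_univ _, i, Set.mem_univ _, rfl⟩)

theorem relIdeal_le_comap_toChow (hk : 0 < k) :
    relIdeal True n k ≤ (uniform k n hkn).chowIdeal.comap (toChow hkn i₀) := by
  refine Ideal.span_le.2 fun p hp => ?_
  rw [SetLike.mem_coe, Ideal.mem_comap]
  cases hp with
  | large G h => rw [toChow_X_of_le hk h]; exact zero_mem _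
  | incomp F G h h' =>
    have hF0 : 0 < F.card := Finset.card_pos.2 (Finset.nonempty_iff_ne_empty.2 (by
      rintro rfl; exact h (Finset.empty_subset _)))
    have hG0 : 0 < G.card := Finset.card_pos.2 (Finset.nonempty_iff_ne_empty.2 (by
      rintro rfl; exact h' (Finset.empty_subset _)))
    rw [map_mul]
    rcases lt_or_ge F.card k with hF | hF
    · rcases lt_or_ge G.card k with hG | hG
      · rw [toChow_X ⟨hF0, hF⟩, toChow_X ⟨hG0, hG⟩]
        refine Ideal.mem_sup_left (Ideal.subset_span ⟨_, _, ?_, ?_, rfl⟩)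
        · exact fun hs => h (Finset.coe_subset.1 hs)
        · exact fun hs => h' (Finset.coe_subset.1 hs)
      · rw [toChow_X_of_le hk hG, mul_zero]; exact zero_mem _
    · rw [toChow_X_of_le hk hF, zero_mul]; exact zero_mem _
  | aug F i h => rw [map_mul]; exact Ideal.mul_mem_left _ _ (toChow_avoidForm_mem hk i)
  | chow i h => exact toChow_avoidForm_mem hk i
  | unit h hk0 => omega

theorem hilbertFn_chowIdeal (hk : 0 < k) (j : ℕ) :
    hilbertFn (uniform k n hkn).chowIdeal j = hilbertFn (relIdeal True n k) j := by
  let i₀ : Fin n := ⟨0, hk.trans_le hkn⟩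
  refine le_antisymm
    (hilbertFn_le_of_surjective _ _ (toChow hkn i₀)
      (fun p hp => relIdeal_le_comap_toChow hk hp) ?_ j)
    (hilbertFn_le_of_surjective _ _ (ofChow hkn)
      (fun p hp => chowIdeal_le_comap hk hp) ?_ j)
  · intro F
    refine ⟨MvPolynomial.X (finsetOf F.1), MvPolynomial.isHomogeneous_X _ _, ?_⟩
    rw [toChow_X_finsetOf, sub_self]
    exact zero_mem _
  · intro G
    rcases lt_or_ge G.card k with hG | hG
    · rcases Nat.eq_zero_or_pos G.card with h0 | h0
      · obtain rfl := Finset.card_eq_zero.1 h0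
        refine ⟨-properAvoidForm hkn i₀, neg_mem (sum_mem fun _ _ =>
          MvPolynomial.isHomogeneous_X _ _), ?_⟩
        rw [map_neg]
        convert sub_mem (IsRel.chow (c := True) (k := k) i₀ trivial).mem
          (avoidForm_sub_ofChow_mem (hkn := hkn) hk i₀) using 1
        ring
      · refine ⟨MvPolynomial.X (toProperFlat hkn G ⟨h0, hG⟩),
          MvPolynomial.isHomogeneous_X _ _, ?_⟩
        rw [ofChow_X]
        simp [toProperFlat]
    · refine ⟨0, zero_mem _, ?_⟩
      rw [map_zero, sub_zero]
      exact (IsRel.large G hG).mem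

end ChowComparison

/-! ### The Hilbert series of the two rings -/

theorem mainTheorem3 (k n : ℕ) (hkn : k ≤ n) (hloopless : (Matroid.uniform k n hkn).Loopless) :
    (0 < k → (Matroid.uniform k n hkn).chowHilbertSeries =
      ((∑ j ∈ Finset.range k, (n.choose j : ℤ[X]) * derangementPoly j *
        ∑ i ∈ Finset.range (k - j), X ^ i : ℤ[X]) : PowerSeries ℤ)) ∧
    (Matroid.uniform k n hkn).augmentedChowHilbertSeries =
      ((1 + X * ∑ j ∈ Finset.range k, (n.choose j : ℤ[X]) * eulerianPoly j *
        ∑ i ∈ Finset.range (k - j), X ^ i : ℤ[X]) : PowerSeries ℤ) := by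
  refine ⟨fun hk => ?_, ?_⟩
  · ext j
    rw [Matroid.chowHilbertSeries, coeff_quotientHilbertSeries, hilbertFn_chowIdeal hk,
      hilbertFn_relIdeal_chow (hk.trans_le hkn) hkn, Polynomial.coeff_coe, chowPoly, zero_mul,
      add_zero]
  · ext j
    rw [Matroid.augmentedChowHilbertSeries, coeff_quotientHilbertSeries,
      hilbertFn_augmentedChowIdeal, hilbertFn_relIdeal_augmented hkn, Polynomial.coeff_coe,
      chowPoly_shiftedEulerianPoly]
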